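/- Let $P_5$ denote the path on five vertices, and let the diamond be the graph obtained from the complete graph $K_4$ by deleting one edge. For a finite simple graph $G$ and a positive integer $k$, a $k$-coloring of $G$ is a map from $V(G)$ to $\{1,\dots,k\}$ that assigns distinct colors to adjacent vertices, and the reconfiguration graph $R_k(G)$ is the graph whose vertices are the $k$-colorings of $G$, two of them being adjacent if they differ in color on exactly one vertex. The graph $G$ is called recolorable if $R_\ell(G)$ is connected for every integer $\ell \ge \chi(G)+1$, where $\chi(G)$ is the chromatic number of $G$. Theorem. Let $G$ be a finite simple graph. If no induced subgraph of $G$ is isomorphic to $P_5$ or to the diamond, then $G$ is recolorable. -/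

import Mathlib

namespace SimpleGraph

universe u v

/-- The diamond: the complete graph on four vertices minus the edge between `0` and `3`. -/
def diamond : SimpleGraph (Fin 4) :=
  (⊤ : SimpleGraph (Fin 4)).deleteEdges {s(0, 3)}

/-- `G.IndFree H`: no induced subgraph of `G` is isomorphic to `H`. -/
def IndFree {V : Type u} {W : Type v} (G : SimpleGraph V) (H : SimpleGraph W) : Prop :=
  ¬ H.IsIndContained G

/-- The reconfiguration graph of the `k`-colorings of `G`: its vertices are the proper colorings
of `G` with colors in `Fin k`, and two colorings are adjacent if they differ in color on exactly
one vertex. -/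
def reconfigurationGraph {V : Type u} (G : SimpleGraph V) (k : ℕ) :
    SimpleGraph (G.Coloring (Fin k)) where
  Adj α β := ∃! x : V, α x ≠ β x
  symm := ⟨fun α β h => by simpa only [ne_comm] using h⟩
  loopless := ⟨fun α h => by
    obtain ⟨x, hx, _⟩ := h
    exact hx rfl⟩

/-- `G` is `k`-mixing if the reconfiguration graph of its `k`-colorings is connected. -/
def IsMixing {V : Type u} (G : SimpleGraph V) (k : ℕ) : Prop :=
  (G.reconfigurationGraph k).Connected

/-- `G` is recolorable if it is `ℓ`-mixing for all `ℓ ≥ χ(G) + 1`. -/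
def IsRecolorable {V : Type u} (G : SimpleGraph V) : Prop :=
  ∀ l : ℕ, G.chromaticNumber + 1 ≤ (l : ℕ∞) → G.IsMixing l

end SimpleGraph

/-! Fix `k` with `G` `k`-colorable, use `k + 1` colors, and argue by induction on the number of
vertices. Three reductions pass to proper induced subgraphs: `G` splits into parts with no edges
between them (`equiv_of_closed`), some vertex has its neighborhood inside that of a nonadjacent
vertex (`equiv_of_neighbors_subset`), or some vertex has degree below `k` (`equiv_of_degree_lt`). A
graph resisting all three satisfies `IsReduced`, and such graphs have very little freedom.

A nonempty reduced graph contains a triangle, so a maximum clique `Q` has at least three vertices.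
Since `G` is diamond-free, a vertex outside `Q` has at most one neighbor in `Q`; excluding `P₅` and
using the reductions, it has exactly one, and the vertices attached to the same `q ∈ Q` form a
stable set. What remains is either the prism over a clique (two copies of `Q` joined by a perfect
matching) or, when `Q` is a triangle, possibly the circulant graph on nine vertices with steps `1`
and `3`.

These graphs are handled through color classes. Write `k = m + 1` and call a stable set good if
deleting it leaves an `m`-colorable graph. Two colorings sharing a good color class are equivalent
by induction on the rest of the graph, and a good color class can be exchanged for any stable set
disjoint from it. In both families counting shows that every coloring has a good class of a specific
shape (a nonadjacent pair, or a translate of `{0, 2, 4}`), and two such classes are either disjoint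
or both disjoint from a third good set. If `G` is itself `m`-colorable, every stable set is good and
the same exchange works at once. -/

namespace SimpleGraph

universe u v w

/-! ### Sequences of recolorings and their transfer between graphs -/

section Recoloring

variable {V : Type u} {C : Type v} {G : SimpleGraph V}

/-- Two colorings that agree outside one vertex. -/
def RecolorStep (α β : G.Coloring C) : Prop := ∃ x, ∀ y, y ≠ x → α y = β y

/-- Two colorings joined by a sequence of recolorings of single vertices. -/
def RecolorEquiv : G.Coloring C → G.Coloring C → Prop := Relation.ReflTransGen RecolorStep

theorem RecolorStep.symm {α β : G.Coloring C} (h : RecolorStep α β) : RecolorStep β α := by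
  obtain ⟨x, hx⟩ := h
  exact ⟨x, fun y hy => (hx y hy).symm⟩

theorem RecolorEquiv.refl (α : G.Coloring C) : RecolorEquiv α α := Relation.ReflTransGen.refl

theorem RecolorEquiv.of_eq {α β : G.Coloring C} (h : ∀ v, α v = β v) : RecolorEquiv α β := by
  have : α = β := RelHom.ext h
  exact this ▸ .refl α

theorem RecolorEquiv.trans {α β γ : G.Coloring C} (h : RecolorEquiv α β)
    (h' : RecolorEquiv β γ) : RecolorEquiv α γ := Relation.ReflTransGen.trans h h'

theorem RecolorEquiv.symm {α β : G.Coloring C} (h : RecolorEquiv α β) : RecolorEquiv β α := by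
  induction h with
  | refl => exact .refl _
  | tail _ h ih => exact Relation.ReflTransGen.head h.symm ih

theorem RecolorEquiv.reachable {k : ℕ} {α β : G.Coloring (Fin k)} (h : RecolorEquiv α β) :
    (G.reconfigurationGraph k).Reachable α β := by
  induction h with
  | refl => exact Reachable.refl _
  | @tail β γ _ h ih =>
    refine ih.trans ?_
    obtain ⟨x, hx⟩ := h
    by_cases h : β x = γ x
    · have : β = γ := RelHom.ext fun y => by
        by_cases hy : y = x
        · exact hy ▸ h
        · exact hx y hy
      exact this ▸ Reachable.refl _
    · exact Adj.reachable ⟨x, h, fun y hy => by_contra fun h => hy (hx y h)⟩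

/-- Colorings that differ only on a stable set can be transformed into each other. -/
theorem RecolorEquiv.of_agree_off [Finite V] (S : Set V)
    (hS : ∀ x ∈ S, ∀ y ∈ S, ¬ G.Adj x y) (α β : G.Coloring C)
    (h : ∀ v, v ∉ S → α v = β v) : RecolorEquiv α β := by
  classical
  have := Fintype.ofFinite V
  induction hn : (Finset.univ.filter fun v => α v ≠ β v).card using Nat.strong_induction_on
    generalizing α with
  | _ n ih =>
  by_cases hall : ∀ v, α v = β v
  · exact .of_eq hall
  push Not at hall
  obtain ⟨x, hx⟩ := hall
  have hxS : x ∈ S := by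
    by_contra h'
    exact hx (h x h')
  -- Giving `x` its final color is safe: all its neighbors lie outside `S` and already have their
  -- colors under `β`.
  have hval : ∀ {v w}, G.Adj v w → Function.update α x (β x) v ≠ Function.update α x (β x) w := by
    intro v w hvw
    by_cases hv : v = x
    · have hw : w ≠ x := fun e => G.loopless.irrefl x (by rwa [hv, e] at hvw)
      have hwS : w ∉ S := fun hw => hS x hxS w hw (hv ▸ hvw)
      rw [hv, Function.update_self, Function.update_of_ne hw, h w hwS]
      exact β.valid (hv ▸ hvw)
    · rw [Function.update_of_ne hv]
      by_cases hw : w = x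
      · have hvS : v ∉ S := fun h' => hS v h' x hxS (hw ▸ hvw)
        rw [hw, Function.update_self, h v hvS]
        exact β.valid (hw ▸ hvw)
      · rw [Function.update_of_ne hw]
        exact α.valid hvw
  let α' : G.Coloring C := Coloring.mk (Function.update α x (β x)) hval
  have hα' : ∀ v, α' v = Function.update α x (β x) v := fun _ => rfl
  have h1 : RecolorStep α α' := ⟨x, fun y hy => by rw [hα', Function.update_of_ne hy]⟩
  refine (Relation.ReflTransGen.single h1).trans (ih _ ?_ α' ?_ rfl)
  · rw [← hn]
    apply Finset.card_lt_card
    rw [Finset.ssubset_iff_of_subset]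
    · exact ⟨x, by simpa using hx, by simp [hα']⟩
    · intro y
      simp only [Finset.mem_filter, Finset.mem_univ, true_and, hα']
      by_cases hy : y = x
      · simp [hy]
      · rw [Function.update_of_ne hy]
        exact id
  · intro v hv
    rw [hα', Function.update_of_ne (by rintro rfl; exact hv hxS)]
    exact h v hv

/-- A sequence of recolorings of an induced subgraph lifts to the whole graph, if the rest can
be kept fixed. -/
theorem RecolorEquiv.lift {D : Type w} (T : Set V) (ext : (G.induce T).Coloring D → G.Coloring C)
    (f : D → C) (o : V → C) (hT : ∀ γ (v : T), ext γ v = f (γ v))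
    (ho : ∀ γ v, v ∉ T → ext γ v = o v) {γ γ' : (G.induce T).Coloring D}
    (h : RecolorEquiv γ γ') : RecolorEquiv (ext γ) (ext γ') := by
  refine Relation.ReflTransGen.lift ext ?_ _ _ h
  rintro γ γ' ⟨x, hx⟩
  refine ⟨x, fun y hy => ?_⟩
  by_cases hyT : y ∈ T
  · have := hx ⟨y, hyT⟩ (fun e => hy (by rw [← e]))
    rw [hT γ ⟨y, hyT⟩, hT γ' ⟨y, hyT⟩, this]
  · rw [ho γ y hyT, ho γ' y hyT]

/-- The coloring of `G` that uses `γ` on `T` and `o` outside `T`. -/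
noncomputable def Coloring.glue {D : Type w} (T : Set V) (f : D → C) (hf : Function.Injective f)
    (o : V → C) (h1 : ∀ v w, v ∉ T → w ∉ T → G.Adj v w → o v ≠ o w)
    (h2 : ∀ v w, v ∈ T → w ∉ T → G.Adj v w → ∀ d, f d ≠ o w) (γ : (G.induce T).Coloring D) :
    G.Coloring C := by
  classical
  exact Coloring.mk (fun v => if hv : v ∈ T then f (γ ⟨v, hv⟩) else o v) (by
    intro v w hvw
    by_cases hv : v ∈ T <;> by_cases hw : w ∈ T <;> simp only [hv, hw, dif_pos, dif_neg,
      not_false_eq_true]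
    · exact fun e => γ.valid (v := ⟨v, hv⟩) (w := ⟨w, hw⟩) hvw (hf e)
    · exact h2 v w hv hw hvw _
    · exact (h2 w v hw hv hvw.symm _).symm
    · exact h1 v w hv hw hvw)

theorem Coloring.glue_of_mem {D : Type w} {T : Set V} {f : D → C} {hf : Function.Injective f}
    {o : V → C} {h1 : ∀ v w, v ∉ T → w ∉ T → G.Adj v w → o v ≠ o w}
    {h2 : ∀ v w, v ∈ T → w ∉ T → G.Adj v w → ∀ d, f d ≠ o w} (γ : (G.induce T).Coloring D)
    (v : T) : Coloring.glue T f hf o h1 h2 γ v = f (γ v) := by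
  exact dif_pos v.2

theorem Coloring.glue_of_notMem {D : Type w} {T : Set V} {f : D → C} {hf : Function.Injective f}
    {o : V → C} {h1 : ∀ v w, v ∉ T → w ∉ T → G.Adj v w → o v ≠ o w}
    {h2 : ∀ v w, v ∈ T → w ∉ T → G.Adj v w → ∀ d, f d ≠ o w} (γ : (G.induce T).Coloring D)
    {v : V} (hv : v ∉ T) : Coloring.glue T f hf o h1 h2 γ v = o v := by
  exact dif_neg hv

/-- The restriction of a coloring to an induced subgraph. -/
def Coloring.restrict (α : G.Coloring C) (T : Set V) : (G.induce T).Coloring C :=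
  Coloring.mk (fun v => α v) (fun h => α.valid h)

/-! ### Reductions to proper induced subgraphs -/

/-- Any two colorings with one color more than needed are joined by recolorings. -/
def MixingAbove (G : SimpleGraph V) : Prop :=
  ∀ (k : ℕ) (C : Type) [Finite C], Nat.card C = k + 1 → G.Colorable k →
    ∀ α β : G.Coloring C, RecolorEquiv α β

theorem Colorable.induce {k : ℕ} (h : G.Colorable k) (T : Set V) : (G.induce T).Colorable k :=
  ⟨h.some.restrict T⟩

/-- No edge joins `S` to its complement, so the two sides can be recolored independently, one after
the other. -/
theorem equiv_of_closed {k : ℕ} {C : Type} [Finite C] (hC : Nat.card C = k + 1)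
    (hk : G.Colorable k) (S : Set V) (hS : ∀ v ∈ S, ∀ w, G.Adj v w → w ∈ S)
    (h1 : (G.induce S).MixingAbove) (h2 : (G.induce Sᶜ).MixingAbove) (α β : G.Coloring C) :
    RecolorEquiv α β := by
  have aux : ∀ (T : Set V), (∀ v ∈ T, ∀ w, G.Adj v w → w ∈ T) → (G.induce T).MixingAbove →
      ∀ α β : G.Coloring C, ∃ δ, RecolorEquiv α δ ∧ (∀ v ∈ T, δ v = β v) ∧
        ∀ v ∉ T, δ v = α v := by
    intro T hT hm α β
    let e := Coloring.glue (G := G) T (fun c : C => c) (fun _ _ h => h) α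
      (fun v w _ _ h => α.valid h) (fun v w hv hw h => (hw (hT v hv w h)).elim)
    refine ⟨e (β.restrict T), ?_, ?_, ?_⟩
    · have := RecolorEquiv.lift T e (fun c => c) α (fun γ v => Coloring.glue_of_mem γ v)
        (fun γ v hv => Coloring.glue_of_notMem γ hv)
        (hm k C hC (hk.induce T) (α.restrict T) (β.restrict T))
      refine RecolorEquiv.trans (.of_eq fun v => ?_) this
      by_cases hv : v ∈ T
      · exact (Coloring.glue_of_mem (f := fun c : C => c) (α.restrict T) ⟨v, hv⟩).symm
      · exact (Coloring.glue_of_notMem _ hv).symm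
    · intro v hv
      exact Coloring.glue_of_mem (β.restrict T) ⟨v, hv⟩
    · intro v hv
      exact Coloring.glue_of_notMem _ hv
  have hS' : ∀ v ∈ Sᶜ, ∀ w, G.Adj v w → w ∈ Sᶜ := fun v hv w h hw => hv (hS w hw v h.symm)
  obtain ⟨δ, h3, h4, h5⟩ := aux S hS h1 α β
  obtain ⟨ε, h6, h7, h8⟩ := aux Sᶜ hS' h2 δ β
  refine (h3.trans h6).trans (.of_eq fun v => ?_)
  by_cases hv : v ∈ S
  · rw [h8 v (by simpa using hv), h4 v hv]
  · exact h7 v hv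

/-- Fold `x` onto `y`: a coloring of `G - x` extends to `G` by letting `x` copy `y`, because
neighbors of `x` are neighbors of `y`. First recolor `x` to the color of `y`, then let it follow `y`
through a recoloring of `G - x`. -/
theorem equiv_of_neighbors_subset [Finite V] {k : ℕ} {C : Type} [Finite C]
    (hC : Nat.card C = k + 1)
    (hk : G.Colorable k) {x y : V} (hxy : x ≠ y) (hadj : ¬ G.Adj x y)
    (hsub : ∀ z, G.Adj x z → G.Adj y z) (h1 : (G.induce {x}ᶜ).MixingAbove) (α β : G.Coloring C) :
    RecolorEquiv α β := by
  classical
  have hy : y ∈ ({x}ᶜ : Set V) := fun e => hxy e.symm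
  let g : V → ({x}ᶜ : Set V) := fun v => if hv : v = x then ⟨y, hy⟩ else ⟨v, hv⟩
  have gx : g x = ⟨y, hy⟩ := dif_pos rfl
  have gne : ∀ v (hv : v ≠ x), g v = ⟨v, hv⟩ := fun v hv => dif_neg hv
  let e : (G.induce {x}ᶜ).Coloring C → G.Coloring C := fun γ => Coloring.mk (fun v => γ (g v)) (by
    intro v w hvw
    apply γ.valid
    by_cases hv : v = x
    · have hw : w ≠ x := fun e => G.loopless.irrefl x (by rwa [hv, e] at hvw)
      rw [hv, gx, gne w hw]
      exact hsub w (hv ▸ hvw)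
    · by_cases hw : w = x
      · rw [hw, gx, gne v hv]
        exact (hsub v (hw ▸ hvw.symm)).symm
      · rw [gne v hv, gne w hw]
        exact hvw)
  have he : ∀ γ v, e γ v = γ (g v) := fun _ _ => rfl
  have hlift : ∀ γ γ', RecolorEquiv γ γ' → RecolorEquiv (e γ) (e γ') := by
    intro γ γ' h
    induction h with
    | refl => exact .refl _
    | @tail β γ _ h ih =>
      refine ih.trans ?_
      obtain ⟨z, hz⟩ := h
      -- A step at `z` changes the whole fiber of `g` over `z`, which is `{x, y}` when `z` is `y`.
      -- The fiber is monochromatic under `e β`, hence stable.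
      refine RecolorEquiv.of_agree_off {v | g v = z} ?_ _ _ ?_
      · intro v hv w hw hvw
        have := (e β).valid hvw
        rw [he, he, hv, hw] at this
        exact this rfl
      · intro v hv
        rw [he, he]
        exact hz _ hv
  have hstart : ∀ α : G.Coloring C, RecolorEquiv α (e (α.restrict {x}ᶜ)) := by
    intro α
    refine RecolorEquiv.of_agree_off {x} ?_ _ _ ?_
    · rintro _ rfl _ rfl
      exact G.loopless.irrefl _
    · intro v hv
      rw [he, gne v hv]
      rfl
  exact ((hstart α).trans (hlift _ _ (h1 k C hC (hk.induce _) _ _))).trans (hstart β).symm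

/-- Follow a recoloring sequence of `G - x`, moving `x` out of the way before each step. Its
neighbors show at most `k - 1` colors and the step introduces at most one more, so one of the `k +
1` colors is always free for `x`. -/
theorem equiv_of_degree_lt [Finite V] {k : ℕ} {C : Type} [Finite C]
    (hC : Nat.card C = k + 1) (hk : G.Colorable k) {x : V} (s : Finset V)
    (hs : ∀ y, G.Adj x y → y ∈ s) (hsk : s.card < k)
    (h1 : (G.induce {x}ᶜ).MixingAbove) (α β : G.Coloring C) : RecolorEquiv α β := by
  classical
  have := Fintype.ofFinite C
  have hC' := hC
  rw [Nat.card_eq_fintype_card] at hC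
  have hstab : ∀ z : V, ∀ v ∈ ({z} : Set V), ∀ w ∈ ({z} : Set V), ¬ G.Adj v w := by
    rintro z _ rfl _ rfl
    exact G.loopless.irrefl _
  have key : ∀ γ γ' : (G.induce {x}ᶜ).Coloring C, RecolorEquiv γ γ' → ∀ α : G.Coloring C,
      (∀ v : ({x}ᶜ : Set V), α v = γ v) →
      ∃ α' : G.Coloring C, RecolorEquiv α α' ∧ ∀ v : ({x}ᶜ : Set V), α' v = γ' v := by
    intro γ γ' h α hα
    induction h with
    | refl => exact ⟨α, .refl _, hα⟩
    | @tail β γ' _ h ih =>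
      obtain ⟨α₁, h2, h3⟩ := ih
      obtain ⟨z, hz⟩ := h
      obtain ⟨e, he⟩ : ∃ e, e ∉ insert (γ' z) (s.image α₁) := by
        by_contra hcon
        push Not at hcon
        have h4 := Finset.card_le_card (fun c _ => hcon c : Finset.univ ⊆ _)
        have h5 := Finset.card_insert_le (γ' z) (s.image α₁)
        have h6 : (s.image α₁).card ≤ s.card := Finset.card_image_le
        rw [Finset.card_univ] at h4
        omega
      simp only [Finset.mem_insert, Finset.mem_image, not_or, not_exists, not_and] at he
      -- The color `e` suits `x` both before and after the step at `z`; this is applied to `β` and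
      -- to `γ'`.
      have hval : ∀ δ : (G.induce {x}ᶜ).Coloring C, (∀ v, v ≠ z → δ v = β v) →
          (δ z = β z ∨ δ z = γ' z) → ∃ ε : G.Coloring C, ε x = e ∧
            ∀ v : ({x}ᶜ : Set V), ε v = δ v := by
        intro δ hδ hδz
        have hne : ∀ v : ({x}ᶜ : Set V), G.Adj x v → δ v ≠ e := by
          intro v hv
          by_cases hvz : v = z
          · rcases hδz with h | h
            · rw [hvz, h, ← h3]
              exact he.2 _ (hs _ (hvz ▸ hv))
            · rw [hvz, h]
              exact fun h => he.1 h.symm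
          · rw [hδ v hvz, ← h3]
            exact he.2 _ (hs _ hv)
        refine ⟨Coloring.mk (fun v => if hv : v = x then e else δ ⟨v, hv⟩) ?_, dif_pos rfl,
          fun v => dif_neg v.2⟩
        intro v w hvw
        by_cases hv : v = x
        · have hw : w ≠ x := fun e => G.loopless.irrefl x (by rwa [hv, e] at hvw)
          simp only [hv, hw, dif_pos, dif_neg, not_false_eq_true]
          exact (hne ⟨w, hw⟩ (hv ▸ hvw)).symm
        · by_cases hw : w = x
          · simp only [hv, hw, dif_pos, dif_neg, not_false_eq_true]
            exact hne ⟨v, hv⟩ (hw ▸ hvw.symm)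
          · simp only [hv, hw, dif_neg, not_false_eq_true]
            exact δ.valid (v := ⟨v, hv⟩) (w := ⟨w, hw⟩) hvw
      obtain ⟨α₃, h6, h7⟩ := hval γ' (fun v hv => (hz v hv).symm) (.inr rfl)
      obtain ⟨α₂, h4, h5⟩ := hval β (fun _ _ => rfl) (.inl rfl)
      refine ⟨α₃, (h2.trans (.of_agree_off {x} (hstab x) _ α₂ ?_)).trans
        (.of_agree_off {z.1} (hstab z) _ _ ?_), h7⟩
      · intro v hv
        rw [h3 ⟨v, hv⟩, h5 ⟨v, hv⟩]
      · intro v hv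
        by_cases hvx : v = x
        · rw [hvx, h4, h6]
        · rw [h5 ⟨v, hvx⟩, h7 ⟨v, hvx⟩]
          exact hz _ fun e => hv (by rw [← e]; rfl)
  obtain ⟨α', h2, h3⟩ := key _ _ (h1 k C hC' (hk.induce _) (α.restrict _) (β.restrict _)) α
    (fun _ => rfl)
  exact h2.trans (.of_agree_off {x} (hstab x) _ _ fun v hv => h3 ⟨v, hv⟩)

end Recoloring

/-! ### Exchanging color classes, with `m + 2` colors -/

section ColorClass

variable {V : Type u} {G : SimpleGraph V} {m : ℕ} {C : Type} [Finite C]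

/-- Removing `c` and `d` leaves at least `m` colors for the rest of the graph. Values of `o` on `S`
are irrelevant. -/
theorem exists_coloring_avoiding (hC : Nat.card C = m + 2) {S : Set V}
    (hcol : (G.induce Sᶜ).Colorable m) (c d : C) :
    ∃ o : V → C, ∀ v ∉ S, o v ≠ c ∧ o v ≠ d ∧ ∀ w ∉ S, G.Adj v w → o v ≠ o w := by
  classical
  have := Fintype.ofFinite C
  rw [Nat.card_eq_fintype_card] at hC
  have hcard : Fintype.card (Fin m) ≤ Fintype.card {x : C // x ∉ ({c, d} : Finset C)} := by
    rw [Fintype.card_subtype_compl, hC, Fintype.card_fin, Fintype.card_coe]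
    have : ({c, d} : Finset C).card ≤ 2 := Finset.card_le_two
    omega
  obtain ⟨g⟩ := Function.Embedding.nonempty_of_card_le hcard
  obtain ⟨γ⟩ := hcol
  refine ⟨fun v => if hv : v ∈ S then c else (g (γ ⟨v, hv⟩)).1, fun v hv => ?_⟩
  have h1 := (g (γ ⟨v, hv⟩)).2
  simp only [Finset.mem_insert, Finset.mem_singleton, not_or] at h1
  refine ⟨by simpa only [hv, dif_neg, not_false_eq_true] using h1.1,
    by simpa only [hv, dif_neg, not_false_eq_true] using h1.2, fun w hw hvw => ?_⟩
  simp only [hv, hw, dif_neg, not_false_eq_true]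
  exact fun e => γ.valid (v := ⟨v, hv⟩) (w := ⟨w, hw⟩) hvw (g.injective (Subtype.ext e))

/-- Freeze `S` in color `c`: the rest is `m`-colorable and has the other `m + 1` colors at its
disposal, so its own mixing property applies. -/
theorem equiv_of_same_colorClass (hC : Nat.card C = m + 2) {S : Set V}
    (hcol : (G.induce Sᶜ).Colorable m) (hmix : (G.induce Sᶜ).MixingAbove) {α β : G.Coloring C}
    {c : C} (hα : ∀ v, α v = c ↔ v ∈ S) (hβ : ∀ v, β v = c ↔ v ∈ S) : RecolorEquiv α β := by
  classical
  have := Fintype.ofFinite C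
  have hC' : Nat.card {x : C // x ≠ c} = m + 1 := by
    rw [Nat.card_eq_fintype_card] at hC ⊢
    rw [Fintype.card_subtype_compl, hC, Fintype.card_subtype_eq]
    rfl
  let r : ∀ α : G.Coloring C, (∀ v, α v = c ↔ v ∈ S) →
      (G.induce Sᶜ).Coloring {x : C // x ≠ c} := fun α h =>
    Coloring.mk (fun v => ⟨α v, fun e => v.2 ((h v).1 e)⟩)
      (fun h e => α.valid h (congrArg Subtype.val e))
  let e := Coloring.glue (G := G) Sᶜ (Subtype.val : {x : C // x ≠ c} → C) Subtype.val_injective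
    (fun _ => c) (fun v w hv hw h => by
      rw [Set.notMem_compl_iff, ← hα] at hv hw
      exact (α.valid h (hv.trans hw.symm)).elim) (fun v w hv hw h d => d.2)
  have he : ∀ (α : G.Coloring C) (h : ∀ v, α v = c ↔ v ∈ S) (v), e (r α h) v = α v := by
    intro α h v
    by_cases hv : v ∈ S
    · exact (Coloring.glue_of_notMem _ (by simpa using hv)).trans ((h v).2 hv).symm
    · exact Coloring.glue_of_mem (r α h) ⟨v, hv⟩
  have := RecolorEquiv.lift Sᶜ e Subtype.val (fun _ => c) (fun γ v => Coloring.glue_of_mem γ v)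
    (fun γ v hv => Coloring.glue_of_notMem γ hv)
    (hmix m _ hC' hcol (r α hα) (r β hβ))
  exact ((RecolorEquiv.of_eq fun v => (he α hα v).symm).trans this).trans (.of_eq (he β hβ))

/-- Recolor the rest so that it avoids both `c` and `d`, switch `S` from `c` to `d` one vertex at a
time, then recolor the rest again. -/
theorem equiv_of_colorClass [Finite V] (hC : Nat.card C = m + 2) {S : Set V}
    (hcol : (G.induce Sᶜ).Colorable m) (hmix : (G.induce Sᶜ).MixingAbove) {α β : G.Coloring C}
    {c d : C} (hα : ∀ v, α v = c ↔ v ∈ S) (hβ : ∀ v, β v = d ↔ v ∈ S) : RecolorEquiv α β := by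
  classical
  have hS : ∀ v ∈ S, ∀ w ∈ S, ¬ G.Adj v w := fun v hv w hw h =>
    α.valid h (((hα v).2 hv).trans ((hα w).2 hw).symm)
  obtain ⟨o, ho⟩ := exists_coloring_avoiding hC hcol c d
  have key : ∀ e, (e = c ∨ e = d) → ∃ δ : G.Coloring C, (∀ v, δ v = e ↔ v ∈ S) ∧
      ∀ v ∉ S, δ v = o v := by
    intro e he
    have hoe : ∀ v ∉ S, o v ≠ e := by
      rcases he with rfl | rfl
      · exact fun v hv => (ho v hv).1
      · exact fun v hv => (ho v hv).2.1
    refine ⟨Coloring.mk (fun v => if v ∈ S then e else o v) ?_, fun v => ?_, fun v hv => if_neg hv⟩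
    · intro v w h
      by_cases hv : v ∈ S <;> by_cases hw : w ∈ S <;> simp only [hv, hw, if_true, if_false]
      · exact (hS v hv w hw h).elim
      · exact (hoe w hw).symm
      · exact hoe v hv
      · exact (ho v hv).2.2 w hw h
    · change (if v ∈ S then e else o v) = e ↔ v ∈ S
      by_cases hv : v ∈ S
      · simp [hv]
      · simpa [hv] using hoe v hv
  obtain ⟨δ, h1, h2⟩ := key c (.inl rfl)
  obtain ⟨ε, h3, h4⟩ := key d (.inr rfl)
  exact ((equiv_of_same_colorClass hC hcol hmix hα h1).trans
    (.of_agree_off S hS δ ε fun v hv => by rw [h2 v hv, h4 v hv])).trans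
    (equiv_of_same_colorClass hC hcol hmix h3 hβ)

/-- A coloring with a color class `S` can be transformed into one with a further color class `T`
disjoint from `S`. -/
theorem exists_equiv_with_colorClass (hC : Nat.card C = m + 2) {S : Set V}
    (hcol : (G.induce Sᶜ).Colorable m) (hmix : (G.induce Sᶜ).MixingAbove) {α : G.Coloring C}
    {c : C} (hα : ∀ v, α v = c ↔ v ∈ S) {T : Set V} (hT : ∀ v ∈ T, ∀ w ∈ T, ¬ G.Adj v w)
    (hST : Disjoint S T) :
    ∃ (β : G.Coloring C) (d : C), RecolorEquiv α β ∧ ∀ v, β v = d ↔ v ∈ T := by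
  classical
  have hS : ∀ v ∈ S, ∀ w ∈ S, ¬ G.Adj v w := fun v hv w hw h =>
    α.valid h (((hα v).2 hv).trans ((hα w).2 hw).symm)
  have hST' : ∀ v ∈ S, v ∉ T := fun v hv => Set.disjoint_left.1 hST hv
  have : Nontrivial C := by
    rw [← Finite.one_lt_card_iff_nontrivial, hC]
    omega
  obtain ⟨d, hd⟩ := exists_ne c
  obtain ⟨o, ho⟩ := exists_coloring_avoiding hC hcol c d
  let β : G.Coloring C := Coloring.mk (fun v => if v ∈ S then c else if v ∈ T then d else o v) (by
    intro v w h
    by_cases hv : v ∈ S <;> by_cases hw : w ∈ S <;> simp only [hv, hw, if_true, if_false]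
    · exact (hS v hv w hw h).elim
    · split_ifs
      · exact hd.symm
      · exact (ho w hw).1.symm
    · split_ifs
      · exact hd
      · exact (ho v hv).1
    · by_cases hv' : v ∈ T <;> by_cases hw' : w ∈ T <;> simp only [hv', hw', if_true, if_false]
      · exact (hT v hv' w hw' h).elim
      · exact (ho w hw).2.1.symm
      · exact (ho v hv).2.1
      · exact (ho v hv).2.2 w hw h)
  have hβ : ∀ v, β v = if v ∈ S then c else if v ∈ T then d else o v := fun _ => rfl
  refine ⟨β, d, equiv_of_same_colorClass hC hcol hmix hα (β := β) fun v => ?_, fun v => ?_⟩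
  · rw [hβ]
    by_cases hv : v ∈ S
    · simp [hv]
    · by_cases hv' : v ∈ T
      · simpa [hv, hv'] using hd
      · simpa [hv, hv'] using (ho v hv).1
  · rw [hβ]
    by_cases hv : v ∈ S
    · simpa [hv, hST' v hv] using hd.symm
    · by_cases hv' : v ∈ T
      · simp [hv, hv']
      · simpa [hv, hv'] using (ho v hv).2.1

theorem equiv_of_disjoint_colorClasses [Finite V] (hC : Nat.card C = m + 2)
    (hmix : ∀ T : Set V, T ≠ Set.univ → (G.induce T).MixingAbove) {S S' : Set V}
    (hS : S.Nonempty) (hS' : S'.Nonempty) (hcol : (G.induce Sᶜ).Colorable m)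
    (hcol' : (G.induce S'ᶜ).Colorable m) {α β : G.Coloring C}
    {c d : C} (hα : ∀ v, α v = c ↔ v ∈ S) (hβ : ∀ v, β v = d ↔ v ∈ S')
    (hdis : Disjoint S S') : RecolorEquiv α β := by
  have hne : ∀ T : Set V, T.Nonempty → Tᶜ ≠ Set.univ := by
    rintro T ⟨v, hv⟩ h
    exact (h ▸ Set.mem_univ v : v ∈ Tᶜ) hv
  obtain ⟨γ, e, h1, h2⟩ := exists_equiv_with_colorClass hC hcol (hmix _ (hne S hS)) hα
    (T := S') (fun v hv w hw h => β.valid h (((hβ v).2 hv).trans ((hβ w).2 hw).symm)) hdis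
  exact h1.trans (equiv_of_colorClass hC hcol' (hmix _ (hne S' hS')) h2 hβ)

theorem equiv_of_common_disjoint [Finite V] (hC : Nat.card C = m + 2)
    (hmix : ∀ T : Set V, T ≠ Set.univ → (G.induce T).MixingAbove) {S S' T : Set V}
    (hS : S.Nonempty) (hS' : S'.Nonempty) (hT : T.Nonempty) (hcol : (G.induce Sᶜ).Colorable m)
    (hcol' : (G.induce S'ᶜ).Colorable m) (hcolT : (G.induce Tᶜ).Colorable m)
    (hTs : ∀ v ∈ T, ∀ w ∈ T, ¬ G.Adj v w) {α β : G.Coloring C}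
    {c d : C} (hα : ∀ v, α v = c ↔ v ∈ S) (hβ : ∀ v, β v = d ↔ v ∈ S')
    (hdis : Disjoint S T) (hdis' : Disjoint S' T) : RecolorEquiv α β := by
  have hne : ∀ T : Set V, T.Nonempty → Tᶜ ≠ Set.univ := by
    rintro T ⟨v, hv⟩ h
    exact (h ▸ Set.mem_univ v : v ∈ Tᶜ) hv
  obtain ⟨γ, e, h1, h2⟩ := exists_equiv_with_colorClass hC hcol (hmix _ (hne S hS)) hα hTs hdis
  exact h1.trans (equiv_of_disjoint_colorClasses hC hmix hT hS' hcolT hcol' h2 hβ hdis'.symm)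

/-- With two colors to spare, the recolorability of the proper induced subgraphs suffices. -/
theorem equiv_of_colorable_of_adj [Finite V] (hC : Nat.card C = m + 2)
    (hmix : ∀ T : Set V, T ≠ Set.univ → (G.induce T).MixingAbove) (hcol : G.Colorable m)
    {x y : V} (hxy : G.Adj x y) (α β : G.Coloring C) : RecolorEquiv α β := by
  refine equiv_of_common_disjoint hC hmix (S := {v | α v = α x}) (S' := {v | β v = β x}) (T := {y})
    ⟨x, rfl⟩ ⟨x, rfl⟩ ⟨y, rfl⟩ (hcol.induce _) (hcol.induce _) (hcol.induce _) ?_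
    (fun _ => Iff.rfl) (fun _ => Iff.rfl) ?_ ?_
  · rintro _ rfl _ rfl
    exact G.loopless.irrefl _
  · exact Set.disjoint_singleton_right.2 (α.valid hxy).symm
  · exact Set.disjoint_singleton_right.2 (β.valid hxy).symm

end ColorClass

/-! ### Use of the forbidden induced subgraphs -/

section Forbidden

variable {V : Type u} {G : SimpleGraph V}

theorem IndFree.induce {W : Type v} {H : SimpleGraph W} (h : G.IndFree H) (T : Set V) :
    (G.induce T).IndFree H :=
  fun h' => h (h'.trans ⟨Embedding.induce T⟩)

/-- Distinctness of the five vertices need not be assumed: no two vertices of `P₅` have the same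
neighborhood, so the adjacency pattern forces it. -/
theorem IndFree.false_of_path (h : G.IndFree (pathGraph 5)) {a b c d e : V} (hab : G.Adj a b)
    (hbc : G.Adj b c) (hcd : G.Adj c d) (hde : G.Adj d e) (hac : ¬ G.Adj a c) (had : ¬ G.Adj a d)
    (hae : ¬ G.Adj a e) (hbd : ¬ G.Adj b d) (hbe : ¬ G.Adj b e) (hce : ¬ G.Adj c e) : False := by
  have hadj : ∀ i j, G.Adj (![a, b, c, d, e] i) (![a, b, c, d, e] j) ↔ (pathGraph 5).Adj i j := by
    intro i j
    rw [pathGraph_adj]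
    fin_cases i <;> fin_cases j <;>
      simp [hab, hbc, hcd, hde, hac, had, hae, hbd, hbe, hce, G.adj_comm b a, G.adj_comm c b,
        G.adj_comm d c, G.adj_comm e d, G.adj_comm c a, G.adj_comm d a, G.adj_comm e a,
        G.adj_comm d b, G.adj_comm e b, G.adj_comm e c]
  have htwin : ∀ i j : Fin 5, (∀ k, (pathGraph 5).Adj i k ↔ (pathGraph 5).Adj j k) → i = j := by
    simp only [pathGraph_adj]
    decide
  have hinj : Function.Injective ![a, b, c, d, e] := fun i j hij => htwin i j fun k => by
    rw [← hadj, ← hadj, hij]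
  exact h ⟨⟨⟨_, hinj⟩, fun {i j} => hadj i j⟩⟩

/-- Otherwise `a, b, c, d` induce a diamond with nonadjacent ends `a` and `d`. These ends are twins
in the diamond, so here `a ≠ d` has to be assumed. -/
theorem IndFree.adj_of_common_neighbors (h : G.IndFree diamond) {a b c d : V} (hbc : G.Adj b c)
    (hab : G.Adj a b) (hac : G.Adj a c) (hdb : G.Adj d b) (hdc : G.Adj d c) (had : a ≠ d) :
    G.Adj a d := by
  by_contra hn
  have hd : ∀ i j : Fin 4, diamond.Adj i j ↔ i ≠ j ∧ s(i, j) ≠ s((0 : Fin 4), 3) := by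
    intro i j
    simp [diamond]
  have hadj : ∀ i j, G.Adj (![a, b, c, d] i) (![a, b, c, d] j) ↔ diamond.Adj i j := by
    intro i j
    rw [hd]
    fin_cases i <;> fin_cases j <;>
      simp [hbc, hab, hac, hdb, hdc, hn, G.adj_comm c b, G.adj_comm b a, G.adj_comm c a,
        G.adj_comm b d, G.adj_comm c d, G.adj_comm d a]
  have hinj : Function.Injective ![a, b, c, d] := by
    intro i j hij
    fin_cases i <;> fin_cases j <;>
      simp [hab.ne, hac.ne, hbc.ne, hdb.ne, hdc.ne, had, hab.ne', hac.ne', hbc.ne', hdb.ne',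
        hdc.ne', had.symm] at hij ⊢
  exact h ⟨⟨⟨_, hinj⟩, fun {i j} => hadj i j⟩⟩

end Forbidden

/-! ### Reduced graphs contain a triangle -/

/-- The properties of a (`P₅`, diamond)-free graph to which none of the reductions for
recoloring with `k + 1` colors applies. -/
structure IsReduced {V : Type u} (G : SimpleGraph V) (k : ℕ) : Prop where
  colorable : G.Colorable k
  pathFree : G.IndFree (pathGraph 5)
  diamondFree : G.IndFree diamond
  exists_adj_not_adj : ∀ x y, x ≠ y → ¬ G.Adj x y → ∃ z, G.Adj x z ∧ ¬ G.Adj y z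
  le_card : ∀ (x) (s : Finset V), (∀ y, G.Adj x y → y ∈ s) → k ≤ s.card
  eq_univ : ∀ S : Set V, S.Nonempty → (∀ v ∈ S, ∀ w, G.Adj v w → w ∈ S) → S = Set.univ

namespace IsReduced

variable {V : Type u} {G : SimpleGraph V} {k : ℕ}

theorem exists_adj (h : G.IsReduced k) (v : V) : ∃ w, G.Adj v w := by
  by_contra hcon
  push Not at hcon
  have hk : k = 0 := Nat.le_zero.1 (h.le_card v ∅ fun y hy => (hcon y hy).elim)
  obtain ⟨γ⟩ := h.colorable
  exact (hk ▸ γ v : Fin 0).elim0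

theorem two_le (h : G.IsReduced k) (v : V) : 2 ≤ k := by
  obtain ⟨w, hw⟩ := h.exists_adj v
  obtain ⟨γ⟩ := h.colorable
  have := γ.valid hw
  rw [Ne, Fin.ext_iff] at this
  have := (γ v).2
  have := (γ w).2
  omega

/-- In a triangle-free reduced graph, two neighbors of `v₀` and private neighbors of these close up
to an induced 5-cycle, as otherwise there is a `P₅`. Any third neighbor of `v₀` again yields a `P₅`,
so `v₀` has degree two and `k ≤ 2`; but an odd cycle is not 2-colorable. -/
theorem exists_triangle (h : G.IsReduced k) (v₀ : V) :
    ∃ a b c, G.Adj a b ∧ G.Adj b c ∧ G.Adj a c := by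
  classical
  by_contra hcon
  push Not at hcon
  have htri : ∀ {a b c}, G.Adj a b → G.Adj b c → ¬ G.Adj a c := fun {a b c} => hcon a b c
  have hk := h.two_le v₀
  obtain ⟨x, hx⟩ := h.exists_adj v₀
  obtain ⟨y, hy, hxy⟩ : ∃ y, G.Adj v₀ y ∧ y ≠ x := by
    by_contra hc
    push Not at hc
    have := h.le_card v₀ {x} fun y hy => Finset.mem_singleton.2 (hc y hy)
    simp at this
    omega
  have hnxy : ¬ G.Adj x y := htri hx.symm hy
  obtain ⟨x', h1, h2⟩ := h.exists_adj_not_adj x y hxy.symm hnxy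
  obtain ⟨y', h3, h4⟩ := h.exists_adj_not_adj y x hxy (fun e => hnxy e.symm)
  have hx'y' : G.Adj x' y' := by
    by_contra hn
    exact h.pathFree.false_of_path h1.symm hx.symm hy h3 (fun e => htri hx h1 e.symm)
      (fun e => h2 e.symm) hn hnxy h4 (htri hy h3)
  -- the neighborhood of a vertex in an induced 5-cycle
  have key : ∀ {v x x' y' y : V}, G.Adj v x → G.Adj x x' → G.Adj x' y' → G.Adj y' y → G.Adj y v →
      ∀ u, G.Adj v u → u ≠ x → ¬ G.Adj u x' := by
    intro v x x' y' y hvx hxx' hxy' hyy' hyv u hvu hux hux'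
    obtain ⟨t, ht, hxt⟩ := h.exists_adj_not_adj u x hux (htri hvu.symm hvx)
    have htv : ¬ G.Adj t v := htri ht.symm hvu.symm
    have htx' : ¬ G.Adj t x' := htri ht.symm hux'
    have huy : ¬ G.Adj u y := fun e => htri hyv hvu e.symm
    have huy' : ¬ G.Adj u y' := htri hux' hxy'
    have hxy : ¬ G.Adj x y := htri hvx.symm hyv.symm
    have hx'y : ¬ G.Adj x' y := htri hxy' hyy'
    have hxy'' : ¬ G.Adj x y' := htri hxx' hxy'
    have hvy' : ¬ G.Adj v y' := htri hyv.symm hyy'.symm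
    by_cases hty : G.Adj t y
    · exact h.pathFree.false_of_path hty hyy'.symm hxy'.symm hxx'.symm
        (htri hty hyy'.symm) htx' (fun e => hxt e.symm) (fun e => hx'y e.symm)
        (fun e => hxy e.symm) (fun e => hxy'' e.symm)
    · by_cases hty' : G.Adj t y'
      · exact h.pathFree.false_of_path hty' hyy' hyv hvx hty htv (fun e => hxt e.symm)
          (fun e => hvy' e.symm) (fun e => hxy'' e.symm) (fun e => hxy e.symm)
      · exact h.pathFree.false_of_path ht.symm hux' hxy' hyy' htx' hty' hty huy' huy hx'y
  have hk2 : k ≤ 2 := by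
    refine (h.le_card v₀ {x, y} fun u hu => ?_).trans Finset.card_le_two
    by_contra hn
    simp only [Finset.mem_insert, Finset.mem_singleton, not_or] at hn
    have hux' := key hx h1 hx'y' h3.symm hy.symm u hu hn.1
    have huy' := key hy h3 hx'y'.symm h1.symm hx.symm u hu hn.2
    exact h.pathFree.false_of_path hu.symm hx h1 hx'y' (htri hu.symm hx) hux' huy'
      (htri hx h1) (htri hy h3) (fun e => h4 e)
  obtain ⟨γ⟩ := h.colorable
  have e1 := γ.valid hx
  have e2 := γ.valid h1
  have e3 := γ.valid hx'y'
  have e4 := γ.valid h3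
  have e5 := γ.valid hy
  rw [Ne, Fin.ext_iff] at e1 e2 e3 e4 e5
  have l1 := (γ v₀).2
  have l2 := (γ x).2
  have l3 := (γ x').2
  have l4 := (γ y').2
  have l5 := (γ y).2
  omega

end IsReduced

variable {V : Type u} {G : SimpleGraph V} {k : ℕ}

/-! ### Structure around a maximum clique -/

/-- `Q` is a clique of maximum size, and has at least three vertices. -/
structure IsLargeMaxClique (G : SimpleGraph V) (Q : Finset V) : Prop where
  isClique : G.IsClique (Q : Set V)
  card_le : ∀ s : Finset V, G.IsClique (s : Set V) → s.card ≤ Q.card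
  three_le : 3 ≤ Q.card

/-- The vertex `a` lies outside the clique `Q` and is adjacent to its vertex `q`. -/
def AttachedTo (G : SimpleGraph V) (Q : Finset V) (q a : V) : Prop :=
  q ∈ Q ∧ a ∉ Q ∧ G.Adj q a

namespace IsReduced

variable {Q : Finset V}

theorem exists_isLargeMaxClique [Finite V] (h : G.IsReduced k) (v : V) :
    ∃ Q, G.IsLargeMaxClique Q := by
  classical
  have := Fintype.ofFinite V
  obtain ⟨a, b, c, hab, hbc, hac⟩ := h.exists_triangle v
  have htri : G.IsClique (({a, b, c} : Finset V) : Set V) := by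
    rw [isClique_iff]
    intro x hx y hy hxy
    simp only [Finset.coe_insert, Finset.coe_singleton, Set.mem_insert_iff,
      Set.mem_singleton_iff] at hx hy
    rcases hx with rfl | rfl | rfl <;> rcases hy with rfl | rfl | rfl <;>
      first | exact (hxy rfl).elim | assumption | (rw [G.adj_comm]; assumption)
  obtain ⟨Q, hQ, hmax⟩ := Finset.exists_max_image
    (Finset.univ.filter fun s : Finset V => G.IsClique (s : Set V)) Finset.card
    ⟨_, Finset.mem_filter.2 ⟨Finset.mem_univ _, htri⟩⟩
  simp only [Finset.mem_filter, Finset.mem_univ, true_and] at hQ hmax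
  refine ⟨Q, hQ, hmax, ?_⟩
  have := hmax _ htri
  rwa [Finset.card_eq_three.2 ⟨a, b, c, hab.ne, hac.ne, hbc.ne, rfl⟩] at this

theorem card_clique_le (h : G.IsReduced k) {s : Finset V} (hs : G.IsClique (s : Set V)) :
    s.card ≤ k := by
  obtain ⟨γ⟩ := h.colorable
  rw [← Fintype.card_fin k, ← Finset.card_univ]
  refine Finset.card_le_card_of_injOn γ (fun _ _ => Finset.mem_univ _) ?_
  intro x hx y hy hxy
  by_contra hne
  exact γ.valid (hs hx hy hne) hxy

end IsReduced

namespace IsLargeMaxClique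

variable {Q : Finset V}

theorem exists_ne_ne (hQ : G.IsLargeMaxClique Q) (i j : V) : ∃ m ∈ Q, m ≠ i ∧ m ≠ j := by
  classical
  obtain ⟨m, hm, hmn⟩ := Finset.exists_mem_notMem_of_card_lt_card
    (s := {i, j}) (t := Q) (lt_of_le_of_lt Finset.card_le_two hQ.three_le)
  simp only [Finset.mem_insert, Finset.mem_singleton, not_or] at hmn
  exact ⟨m, hm, hmn⟩

/-- With two neighbors in `Q`, diamond-freeness would make `a` adjacent to all of `Q`, contradicting
maximality. -/
theorem attachedTo_unique (hQ : G.IsLargeMaxClique Q) (hd : G.IndFree diamond) {q q' a : V}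
    (h : G.AttachedTo Q q a) (h' : G.AttachedTo Q q' a) : q = q' := by
  classical
  by_contra hne
  have hqq' := hQ.isClique h.1 h'.1 hne
  have hall : ∀ p ∈ Q, G.Adj a p := by
    intro p hp
    by_cases h1 : p = q
    · exact h1 ▸ h.2.2.symm
    by_cases h2 : p = q'
    · exact h2 ▸ h'.2.2.symm
    exact hd.adj_of_common_neighbors hqq' h.2.2.symm h'.2.2.symm (hQ.isClique hp h.1 h1)
      (hQ.isClique hp h'.1 h2) (fun e => h.2.1 (e ▸ hp))
  have hcl : G.IsClique ((insert a Q : Finset V) : Set V) := by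
    rw [Finset.coe_insert]
    exact hQ.isClique.insert fun p hp _ => hall p hp
  have := hQ.card_le _ hcl
  rw [Finset.card_insert_of_notMem h.2.1] at this
  omega

theorem not_adj_of_ne (hQ : G.IsLargeMaxClique Q) (hd : G.IndFree diamond) {q q' a : V}
    (h : G.AttachedTo Q q a) (hq' : q' ∈ Q) (hne : q' ≠ q) : ¬ G.Adj q' a :=
  fun hadj => hne (hQ.attachedTo_unique hd ⟨hq', h.2.1, hadj⟩ h)

variable (hQ : G.IsLargeMaxClique Q) (h : G.IsReduced k)
include hQ h

/-- The degree of `q` is at least `k ≥ |Q|`, while `Q` supplies only `|Q| - 1` neighbors. -/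
theorem exists_attachedTo {q : V} (hq : q ∈ Q) : ∃ a, G.AttachedTo Q q a := by
  classical
  by_contra hcon
  push Not at hcon
  have h1 := h.le_card q (Q.erase q) fun y hy => by
    refine Finset.mem_erase.2 ⟨hy.ne', ?_⟩
    by_contra hyQ
    exact hcon y ⟨hq, hyQ, hy⟩
  have h2 := h.card_clique_le hQ.isClique
  have h3 := Finset.card_erase_lt_of_mem hq
  omega

/-- An edge between two classes dominates the other classes. -/
theorem adj_or_adj {i j l a b x : V} (hij : i ≠ j) (hil : i ≠ l) (hjl : j ≠ l)
    (ha : G.AttachedTo Q i a) (hb : G.AttachedTo Q j b) (hx : G.AttachedTo Q l x)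
    (hbx : G.Adj b x) : G.Adj a b ∨ G.Adj a x := by
  by_contra hcon
  push Not at hcon
  have hd := h.diamondFree
  exact h.pathFree.false_of_path hbx hx.2.2.symm (hQ.isClique hx.1 ha.1 hil.symm) ha.2.2
    (fun e => hQ.not_adj_of_ne hd hb hx.1 hjl.symm e.symm)
    (fun e => hQ.not_adj_of_ne hd hb ha.1 hij e.symm) (fun e => hcon.1 e.symm)
    (fun e => hQ.not_adj_of_ne hd hx ha.1 hil e.symm) (fun e => hcon.2 e.symm)
    (hQ.not_adj_of_ne hd ha hx.1 hil.symm)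

/-- Here `r` has no neighbor in `Q`. From an edge `b x` between two classes one builds a system of
representatives, one attached vertex per element of `Q`, which together with `r` is a clique larger
than `Q`. -/
theorem not_adj_of_far_neighbor {r j b i x : V} (hr : ∀ q ∈ Q, ¬ G.Adj q r)
    (hb : G.AttachedTo Q j b) (hrb : G.Adj r b) (hx : G.AttachedTo Q i x) (hij : i ≠ j) :
    ¬ G.Adj b x := by
  classical
  have hd := h.diamondFree
  -- neighbors of `b` in other classes are neighbors of `r`
  have key : ∀ {j b i x}, G.AttachedTo Q j b → G.Adj r b → G.AttachedTo Q i x → i ≠ j →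
      G.Adj b x → G.Adj r x := by
    intro j b i x hb hrb hx hij hbx
    by_contra hrx
    obtain ⟨m, hm, hmi, hmj⟩ := hQ.exists_ne_ne i j
    exact h.pathFree.false_of_path (hQ.isClique hm hx.1 hmi) hx.2.2 hbx.symm hrb.symm
      (hQ.not_adj_of_ne hd hx hm hmi) (hQ.not_adj_of_ne hd hb hm hmj) (hr m hm)
      (hQ.not_adj_of_ne hd hb hx.1 hij) (hr i hx.1) (fun e => hrx e.symm)
  intro hbx
  have hrx := key hb hrb hx hij hbx
  -- The representative of each class is adjacent to `r` and, outside class `j`, to `b`. Any two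
  -- outside class `j` then share the adjacent neighbors `r` and `b`, so they are adjacent. Outside
  -- `Q` the value is junk.
  have hg : ∀ q, ∃ a, q ∈ Q → G.AttachedTo Q q a ∧ G.Adj r a ∧ (q = j → a = b) ∧
      (q ≠ j → G.Adj b a) := by
    intro q
    by_cases hq : q ∈ Q
    swap
    · exact ⟨q, fun hq' => (hq hq').elim⟩
    by_cases hqj : q = j
    · exact ⟨b, fun _ => ⟨hqj ▸ hb, hrb, fun _ => rfl, fun h' => (h' hqj).elim⟩⟩
    by_cases hqi : q = i
    · exact ⟨x, fun _ => ⟨hqi ▸ hx, hrx, fun h' => (hqj h').elim, fun _ => hbx⟩⟩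
    obtain ⟨a, ha⟩ := hQ.exists_attachedTo h hq
    have hax : a ≠ x := fun e => hqi (hQ.attachedTo_unique hd ha (e ▸ hx))
    have hra : G.Adj r a := by
      rcases hQ.adj_or_adj h hqj hqi hij.symm ha hb hx hbx with h1 | h1
      · exact key hb hrb ha hqj h1.symm
      · exact key hx hrx ha hqi h1.symm
    refine ⟨a, fun _ => ⟨ha, hra, fun h' => (hqj h').elim, fun _ => ?_⟩⟩
    rcases hQ.adj_or_adj h hqj hqi hij.symm ha hb hx hbx with h1 | h1
    · exact h1.symm
    · exact (hd.adj_of_common_neighbors hrx hra.symm h1 hrb.symm hbx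
        (fun e => hqj (hQ.attachedTo_unique hd ha (e ▸ hb)))).symm
  choose g hg using hg
  have hinj : Set.InjOn g Q := fun q hq q' hq' e =>
    hQ.attachedTo_unique hd (hg q hq).1 (e ▸ (hg q' hq').1)
  have hcl : G.IsClique ((insert r (Q.image g) : Finset V) : Set V) := by
    rw [Finset.coe_insert, Finset.coe_image]
    refine IsClique.insert ?_ ?_
    · rw [isClique_iff]
      rintro _ ⟨q, hq, rfl⟩ _ ⟨q', hq', rfl⟩ hne
      by_cases hqj : q = j
      · rw [(hg q hq).2.2.1 hqj]
        exact (hg q' hq').2.2.2 fun e => hne (by rw [hqj, e])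
      by_cases hqj' : q' = j
      · rw [(hg q' hq').2.2.1 hqj']
        exact ((hg q hq).2.2.2 hqj).symm
      exact hd.adj_of_common_neighbors hrb (hg q hq).2.1.symm ((hg q hq).2.2.2 hqj).symm
        (hg q' hq').2.1.symm ((hg q' hq').2.2.2 hqj').symm hne
    · rintro _ ⟨q, hq, rfl⟩ _
      exact (hg q hq).2.1
  have hrn : r ∉ Q.image g := by
    intro hmem
    obtain ⟨q, hq, e⟩ := Finset.mem_image.1 hmem
    exact hr q hq (e ▸ (hg q hq).1.2.2)
  have := hQ.card_le _ hcl
  rw [Finset.card_insert_of_notMem hrn, Finset.card_image_of_injOn hinj] at this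
  omega

/-- If `a` is in another class than `b` and not adjacent to `r`, then `r, b, j, i, a` is an induced
`P₅`. The class of `b` itself is reached by way of a third class. -/
theorem adj_of_far_neighbor {r j b i a : V} (hr : ∀ q ∈ Q, ¬ G.Adj q r)
    (hb : G.AttachedTo Q j b) (hrb : G.Adj r b) (ha : G.AttachedTo Q i a) : G.Adj r a := by
  have hd := h.diamondFree
  have key : ∀ {j b i a}, G.AttachedTo Q j b → G.Adj r b → G.AttachedTo Q i a → i ≠ j →
      G.Adj r a := by
    intro j b i a hb hrb ha hij
    by_contra hra
    have hba := hQ.not_adj_of_far_neighbor h hr hb hrb ha hij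
    exact h.pathFree.false_of_path hrb hb.2.2.symm (hQ.isClique hb.1 ha.1 hij.symm) ha.2.2
      (fun e => hr j hb.1 e.symm) (fun e => hr i ha.1 e.symm) hra
      (fun e => hQ.not_adj_of_ne hd hb ha.1 hij e.symm) hba
      (hQ.not_adj_of_ne hd ha hb.1 hij.symm)
  by_cases hij : i = j
  · obtain ⟨m, hm, hmi, hmj⟩ := hQ.exists_ne_ne i j
    obtain ⟨c, hc⟩ := hQ.exists_attachedTo h hm
    exact key hc (key hb hrb hc hmj) ha hmi.symm
  · exact key hb hrb ha hij

/-- If a vertex at distance two from `Q` existed, it would be complete to the attached vertices, and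
these would form a stable set. Two such vertices adjacent to `b` would have comparable
neighborhoods, so `b` would have only the neighbors `j` and `r`, against `k ≥ |Q| ≥ 3`. -/
theorem not_adj_far {r j b : V} (hrQ : r ∉ Q) (hr : ∀ q ∈ Q, ¬ G.Adj q r)
    (hb : G.AttachedTo Q j b) : ¬ G.Adj r b := by
  classical
  have hd := h.diamondFree
  intro hrb
  have hcomp : ∀ {r i a}, (∀ q ∈ Q, ¬ G.Adj q r) → G.Adj r b → G.AttachedTo Q i a →
      G.Adj r a := fun hr hrb ha => hQ.adj_of_far_neighbor h hr hb hrb ha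
  have hstab : ∀ {i a i' a'}, G.AttachedTo Q i a → G.AttachedTo Q i' a' → ¬ G.Adj a a' := by
    intro i a i' a' ha ha' haa'
    by_cases hii' : i' = i
    · subst hii'
      exact hr i' ha.1 (hd.adj_of_common_neighbors haa' ha.2.2 ha'.2.2 (hcomp hr hrb ha)
        (hcomp hr hrb ha') (fun e => hrQ (e ▸ ha.1)))
    · exact hQ.not_adj_of_far_neighbor h hr ha (hcomp hr hrb ha) ha' hii' haa'
  -- the neighbors of a vertex at distance two from `Q` are exactly the attached vertices
  have hnbr : ∀ {s y}, (∀ q ∈ Q, ¬ G.Adj q s) → G.Adj s b → G.Adj s y →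
      ∃ q, G.AttachedTo Q q y := by
    intro s y hs hsb hsy
    by_contra hcon
    push Not at hcon
    have hyQ : y ∉ Q := fun hy => hs y hy hsy.symm
    have hy : ∀ q ∈ Q, ¬ G.Adj q y := fun q hq e => hcon q ⟨hq, hyQ, e⟩
    obtain ⟨m, hm, hmj, -⟩ := hQ.exists_ne_ne j j
    by_cases hyb : G.Adj y b
    · obtain ⟨c, hc⟩ := hQ.exists_attachedTo h hm
      exact hstab hb hc (hd.adj_of_common_neighbors hsy hsb.symm hyb.symm
        (hcomp hs hsb hc).symm (hcomp hy hyb hc).symm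
        (fun e => hmj (hQ.attachedTo_unique hd hc (e ▸ hb))))
    · exact h.pathFree.false_of_path hsy.symm hsb hb.2.2.symm (hQ.isClique hb.1 hm hmj.symm) hyb
        (fun e => hy j hb.1 e.symm) (fun e => hy m hm e.symm) (fun e => hs j hb.1 e.symm)
        (fun e => hs m hm e.symm) (fun e => hQ.not_adj_of_ne hd hb hm hmj e.symm)
  have hbn : ∀ y, G.Adj b y → y ∈ ({j, r} : Finset V) := by
    intro y hby
    rw [Finset.mem_insert, Finset.mem_singleton]
    by_cases hyQ : y ∈ Q
    · left
      by_contra hyj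
      exact hQ.not_adj_of_ne hd hb hyQ hyj hby.symm
    · right
      have hy : ∀ q ∈ Q, ¬ G.Adj q y := fun q hq e => hstab hb ⟨hq, hyQ, e⟩ hby
      by_contra hyr
      have hnyr : ¬ G.Adj y r := by
        intro e
        obtain ⟨q, hq⟩ := hnbr hy hby.symm e
        exact hr q hq.1 hq.2.2
      obtain ⟨z, hz, hz'⟩ := h.exists_adj_not_adj y r hyr hnyr
      obtain ⟨q, hq⟩ := hnbr hy hby.symm hz
      exact hz' (hcomp hr hrb hq)
  have h1 := (h.le_card b _ hbn).trans Finset.card_le_two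
  have h2 := h.card_clique_le hQ.isClique
  have h3 := hQ.three_le
  omega

theorem mem_or_attachedTo (v : V) : v ∈ Q ∨ ∃ q, G.AttachedTo Q q v := by
  have huniv := h.eq_univ {v | v ∈ Q ∨ ∃ q, G.AttachedTo Q q v} ?_ ?_
  · exact Set.eq_univ_iff_forall.1 huniv v
  · obtain ⟨m, hm, -⟩ := hQ.exists_ne_ne v v
    exact ⟨m, .inl hm⟩
  · intro x hx y hxy
    by_contra hcon
    simp only [Set.mem_ofPred_eq, not_or, not_exists] at hcon
    have hy : ∀ q ∈ Q, ¬ G.Adj q y := fun q hq e => hcon.2 q ⟨hq, hcon.1, e⟩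
    rcases hx with hx | ⟨q, hq⟩
    · exact hy x hx hxy
    · exact hQ.not_adj_far h hcon.1 hy hq hxy.symm

/-- If `a'` has a neighbor `x` in another class `l`, then `a, a', x, l, m` is an induced `P₅` for a
further `m ∈ Q`. If not, the closed neighborhood of `a'` is a clique with at least `k + 1` vertices.
-/
theorem not_adj_of_attachedTo_same [Finite V] {i a a' : V} (ha : G.AttachedTo Q i a)
    (ha' : G.AttachedTo Q i a') : ¬ G.Adj a a' := by
  classical
  intro haa'
  have hd := h.diamondFree
  by_cases hcross : ∃ l x, l ≠ i ∧ G.AttachedTo Q l x ∧ G.Adj a' x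
  · obtain ⟨l, x, hli, hx, ha'x⟩ := hcross
    obtain ⟨m, hm, hmi, hml⟩ := hQ.exists_ne_ne i l
    have hax : ¬ G.Adj a x := fun hax => hQ.not_adj_of_ne hd hx ha.1 hli.symm
      (hd.adj_of_common_neighbors haa' ha.2.2 ha'.2.2 hax.symm ha'x.symm
        (fun e => hx.2.1 (e ▸ ha.1)))
    exact h.pathFree.false_of_path haa' ha'x hx.2.2.symm (hQ.isClique hx.1 hm hml.symm) hax
      (fun e => hQ.not_adj_of_ne hd ha hx.1 hli e.symm)
      (fun e => hQ.not_adj_of_ne hd ha hm hmi e.symm)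
      (fun e => hQ.not_adj_of_ne hd ha' hx.1 hli e.symm)
      (fun e => hQ.not_adj_of_ne hd ha' hm hmi e.symm)
      (fun e => hQ.not_adj_of_ne hd hx hm hml e.symm)
  · push Not at hcross
    -- otherwise the closed neighborhood of `a'` is a clique
    have hnb : ∀ y, G.Adj a' y → y = i ∨ G.AttachedTo Q i y := by
      intro y hy
      rcases hQ.mem_or_attachedTo h y with hyQ | ⟨q, hq⟩
      · left
        by_contra hyi
        exact hQ.not_adj_of_ne hd ha' hyQ hyi hy.symm
      · by_cases hqi : q = i
        · exact .inr (hqi ▸ hq)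
        · exact (hcross q y hqi hq hy).elim
    have hfin : {y | G.Adj a' y}.Finite := Set.toFinite _
    have hcl : G.IsClique ((insert a' hfin.toFinset : Finset V) : Set V) := by
      rw [Finset.coe_insert]
      refine IsClique.insert ?_ ?_
      · rw [isClique_iff]
        intro y hy z hz hyz
        simp only [Set.Finite.coe_toFinset, Set.mem_ofPred_eq] at hy hz
        rcases hnb y hy with rfl | hy'
        · rcases hnb z hz with rfl | hz'
          · exact (hyz rfl).elim
          · exact hz'.2.2
        · rcases hnb z hz with rfl | hz'
          · exact hy'.2.2.symm
          · exact hd.adj_of_common_neighbors ha'.2.2 hy'.2.2.symm hy.symm hz'.2.2.symm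
              hz.symm hyz
      · intro y hy _
        simpa using hy
    have h1 := h.le_card a' hfin.toFinset fun y hy => by simpa using hy
    have h2 := h.card_clique_le hcl
    rw [Finset.card_insert_of_notMem (by simp)] at h2
    omega

end IsLargeMaxClique

/-! ### Classification: clique prism or circulant graph -/

/-- The vertices attached to the clique `Q` form a clique, matched with `Q`. -/
structure IsCliquePrism (G : SimpleGraph V) (Q : Finset V) : Prop where
  unique : ∀ {i a a'}, G.AttachedTo Q i a → G.AttachedTo Q i a' → a = a'
  adj : ∀ {i j a b}, i ≠ j → G.AttachedTo Q i a → G.AttachedTo Q j b → G.Adj a b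

/-- The adjacency relation of the circulant graph on nine vertices with steps `1` and `3`. -/
abbrev CirculantAdj (i j : Fin 9) : Prop := j - i = 1 ∨ j - i = 3 ∨ j - i = 6 ∨ j - i = 8

namespace IsLargeMaxClique

variable {Q : Finset V}

theorem eq_or_eq_or_eq {Q : Finset V} (h3 : Q.card = 3) {i j l : V} (hi : i ∈ Q) (hj : j ∈ Q)
    (hl : l ∈ Q) (hij : i ≠ j) (hil : i ≠ l) (hjl : j ≠ l) {q : V} (hq : q ∈ Q) :
    q = i ∨ q = j ∨ q = l := by
  classical
  have hsub : ({i, j, l} : Finset V) ⊆ Q := by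
    intro x hx
    simp only [Finset.mem_insert, Finset.mem_singleton] at hx
    rcases hx with rfl | rfl | rfl <;> assumption
  have heq := Finset.eq_of_subset_of_card_le hsub
    (by rw [h3, Finset.card_eq_three.2 ⟨i, j, l, hij, hil, hjl, rfl⟩])
  rw [← heq] at hq
  simpa using hq

variable [Finite V] (hQ : G.IsLargeMaxClique Q) (h : G.IsReduced k)
include hQ h

theorem exists_cross_neighbor {i a : V} (ha : G.AttachedTo Q i a) :
    ∃ j b, j ≠ i ∧ G.AttachedTo Q j b ∧ G.Adj a b := by
  by_contra hcon
  push Not at hcon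
  have h1 := h.le_card a {i} fun y hy => by
    rw [Finset.mem_singleton]
    by_contra hyi
    rcases hQ.mem_or_attachedTo h y with hyQ | ⟨q, hq⟩
    · exact hQ.not_adj_of_ne h.diamondFree ha hyQ hyi hy.symm
    · by_cases hqi : q = i
      · exact hQ.not_adj_of_attachedTo_same h ha (hqi ▸ hq) hy
      · exact hcon q y hqi hq hy
  have h2 := h.two_le a
  simp at h1
  omega

/-- A fourth vertex `m` of `Q` starts the path `m, i, a, x, y`, which strengthens `adj_or_adj`: a
vertex of a third class is adjacent to both ends of an edge between two classes. Two vertices in one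
class would then be the ends of a diamond. -/
theorem isCliquePrism_of_four_le (h4 : 4 ≤ Q.card) : G.IsCliquePrism Q := by
  classical
  have hd := h.diamondFree
  have htrans : ∀ {i j l a x y}, i ≠ j → i ≠ l → j ≠ l → G.AttachedTo Q i a →
      G.AttachedTo Q j x → G.AttachedTo Q l y → G.Adj a x → G.Adj x y → G.Adj a y := by
    intro i j l a x y hij hil hjl ha hx hy hax hxy
    by_contra hay
    obtain ⟨m, hm, hmn⟩ := Finset.exists_mem_notMem_of_card_lt_card
      (s := {i, j, l}) (t := Q) (lt_of_le_of_lt Finset.card_le_three h4)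
    simp only [Finset.mem_insert, Finset.mem_singleton, not_or] at hmn
    exact h.pathFree.false_of_path (hQ.isClique hm ha.1 hmn.1) ha.2.2 hax hxy
      (hQ.not_adj_of_ne hd ha hm hmn.1) (hQ.not_adj_of_ne hd hx hm hmn.2.1)
      (hQ.not_adj_of_ne hd hy hm hmn.2.2) (hQ.not_adj_of_ne hd hx ha.1 hij)
      (hQ.not_adj_of_ne hd hy ha.1 hil) hay
  have hboth : ∀ {i j l a b x}, i ≠ j → i ≠ l → j ≠ l → G.AttachedTo Q i a →
      G.AttachedTo Q j b → G.AttachedTo Q l x → G.Adj b x → G.Adj a b ∧ G.Adj a x := by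
    intro i j l a b x hij hil hjl ha hb hx hbx
    rcases hQ.adj_or_adj h hij hil hjl ha hb hx hbx with h1 | h1
    · exact ⟨h1, htrans hij hil hjl ha hb hx h1 hbx⟩
    · exact ⟨htrans hil hij hjl.symm ha hx hb h1 hbx.symm, h1⟩
  refine ⟨fun {i c c'} hc hc' => ?_, fun {i j a b} hij ha hb => ?_⟩
  · by_contra hne
    obtain ⟨j, x, hji, hx, hcx⟩ := hQ.exists_cross_neighbor h hc
    obtain ⟨l, hl, hli, hlj⟩ := hQ.exists_ne_ne i j
    obtain ⟨y, hy⟩ := hQ.exists_attachedTo h hl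
    have h1 := hboth hli hlj hji.symm hy hc hx hcx
    have h2 := hboth hji.symm hli.symm hlj.symm hc' hx hy h1.2.symm
    exact hQ.not_adj_of_attachedTo_same h hc hc' (hd.adj_of_common_neighbors h1.2 h1.1.symm hcx
      h2.2 h2.1 hne)
  · obtain ⟨l, x, hli, hx, hax⟩ := hQ.exists_cross_neighbor h ha
    by_cases hjl : j = l
    · subst hjl
      obtain ⟨m, hm, hmi, hmj⟩ := hQ.exists_ne_ne i j
      obtain ⟨y, hy⟩ := hQ.exists_attachedTo h hm
      have h1 := hboth hmi hmj hij hy ha hx hax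
      exact (hboth hij.symm hmj.symm hmi.symm hb ha hy h1.1.symm).1.symm
    · exact (hboth hij.symm hjl hli.symm hb ha hx hax).1.symm

/-- Compare `a` with the third vertex `l` of `Q`: some neighbor of `a` is not adjacent to `l`, and
this excludes everything but the class of `j`. -/
theorem exists_adj_attachedTo (h3 : Q.card = 3) {i j a : V} (ha : G.AttachedTo Q i a)
    (hj : j ∈ Q) (hij : j ≠ i) : ∃ b, G.AttachedTo Q j b ∧ G.Adj a b := by
  obtain ⟨l, hl, hli, hlj⟩ := hQ.exists_ne_ne i j
  obtain ⟨z, haz, hlz⟩ := h.exists_adj_not_adj a l (fun e => ha.2.1 (e ▸ hl))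
    (fun e => hQ.not_adj_of_ne h.diamondFree ha hl hli e.symm)
  rcases hQ.mem_or_attachedTo h z with hz | ⟨q, hq⟩
  · by_cases hzi : z = i
    · exact (hlz (hzi ▸ hQ.isClique hl ha.1 hli)).elim
    · exact (hQ.not_adj_of_ne h.diamondFree ha hz hzi haz.symm).elim
  · rcases eq_or_eq_or_eq h3 ha.1 hj hl hij.symm hli.symm hlj.symm hq.1 with rfl | rfl | rfl
    · exact (hQ.not_adj_of_attachedTo_same h ha hq haz).elim
    · exact ⟨z, hq, haz⟩
    · exact (hlz hq.2.2).elim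

/-- Without such a triangle, following cross edges through the three classes forces adjacencies
until the edge `a b'` has no neighbor of `c'` among its ends, contradicting `adj_or_adj`. -/
theorem exists_attached_triangle (h3 : Q.card = 3) {i j l : V} (hi : i ∈ Q) (hj : j ∈ Q)
    (hl : l ∈ Q) (hij : i ≠ j) (hil : i ≠ l) (hjl : j ≠ l) :
    ∃ a b c, G.AttachedTo Q i a ∧ G.AttachedTo Q j b ∧ G.AttachedTo Q l c ∧
      G.Adj a b ∧ G.Adj b c ∧ G.Adj a c := by
  by_contra hcon
  have htri : ∀ {a b c}, G.AttachedTo Q i a → G.AttachedTo Q j b → G.AttachedTo Q l c →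
      G.Adj a b → G.Adj b c → ¬ G.Adj a c := fun ha hb hc hab hbc hac =>
    hcon ⟨_, _, _, ha, hb, hc, hab, hbc, hac⟩
  have hst : ∀ {q a a'}, G.AttachedTo Q q a → G.AttachedTo Q q a' → ¬ G.Adj a a' :=
    fun ha ha' => hQ.not_adj_of_attachedTo_same h ha ha'
  obtain ⟨a, ha⟩ := hQ.exists_attachedTo h hi
  obtain ⟨b, hb, hab⟩ := hQ.exists_adj_attachedTo h h3 ha hj hij.symm
  obtain ⟨c, hc, hac⟩ := hQ.exists_adj_attachedTo h h3 ha hl hil.symm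
  obtain ⟨c', hc', hbc'⟩ := hQ.exists_adj_attachedTo h h3 hb hl hjl.symm
  obtain ⟨a', ha', hc'a'⟩ := hQ.exists_adj_attachedTo h h3 hc' hi hil
  obtain ⟨b', hb', ha'b'⟩ := hQ.exists_adj_attachedTo h h3 ha' hj hij.symm
  have hbc : ¬ G.Adj b c := fun e => htri ha hb hc hab e hac
  have hac' : ¬ G.Adj a c' := htri ha hb hc' hab hbc'
  have ha'b : ¬ G.Adj a' b := fun e => htri ha' hb hc' e hbc' hc'a'.symm
  have ha'c : G.Adj a' c := by
    by_contra hn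
    exact h.pathFree.false_of_path hc'a'.symm hbc'.symm hab.symm hac ha'b (hst ha' ha) hn
      (fun e => hac' e.symm) (hst hc' hc) hbc
  have hb'c' : ¬ G.Adj b' c' := fun e => htri ha' hb' hc' ha'b' e hc'a'.symm
  have hb'c : ¬ G.Adj b' c := fun e => htri ha' hb' hc ha'b' e ha'c
  have hb'a : G.Adj b' a := (hQ.adj_or_adj h hij.symm hjl hil hb' ha hc hac).resolve_right hb'c
  rcases hQ.adj_or_adj h hil.symm hjl.symm hij hc' ha hb' hb'a.symm with e | e
  · exact hac' e.symm
  · exact hb'c' e.symm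

/-- The extra vertex `x` in the class of `q₁` forces a third triangle `x, w, z`, linked to both `Q`
and the triangle of the `aᵢ`; these nine vertices exhaust the graph. -/
theorem exists_circulant (h3 : Q.card = 3) {q₁ q₂ q₃ a₁ a₂ a₃ x : V} (h12 : q₁ ≠ q₂)
    (h13 : q₁ ≠ q₃) (h23 : q₂ ≠ q₃) (ha₁ : G.AttachedTo Q q₁ a₁) (ha₂ : G.AttachedTo Q q₂ a₂)
    (ha₃ : G.AttachedTo Q q₃ a₃) (e12 : G.Adj a₁ a₂) (e23 : G.Adj a₂ a₃) (e13 : G.Adj a₁ a₃)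
    (hx : G.AttachedTo Q q₁ x) (hxa : x ≠ a₁) (hx2 : G.Adj x a₂) :
    ∃ f : Fin 9 → V, Function.Surjective f ∧ ∀ i j, G.Adj (f i) (f j) ↔ CirculantAdj i j := by
  classical
  have hd := h.diamondFree
  have hst : ∀ {q a a'}, G.AttachedTo Q q a → G.AttachedTo Q q a' → ¬ G.Adj a a' :=
    fun ha ha' => hQ.not_adj_of_attachedTo_same h ha ha'
  have hne : ∀ {q q' a a'}, q ≠ q' → G.AttachedTo Q q a → G.AttachedTo Q q' a' → a ≠ a' :=
    fun hqq' ha ha' e => hqq' (hQ.attachedTo_unique hd ha (e ▸ ha'))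
  -- The attached triangle is itself a maximum clique, so everything known about `Q` applies to it
  -- too.
  have hT : G.IsLargeMaxClique {a₁, a₂, a₃} := by
    have hcard : ({a₁, a₂, a₃} : Finset V).card = 3 :=
      Finset.card_eq_three.2 ⟨_, _, _, e12.ne, e13.ne, e23.ne, rfl⟩
    refine ⟨?_, fun s hs => ?_, hcard.ge⟩
    · rw [isClique_iff]
      intro x hx y hy hxy
      simp only [Finset.coe_insert, Finset.coe_singleton, Set.mem_insert_iff,
        Set.mem_singleton_iff] at hx hy
      rcases hx with rfl | rfl | rfl <;> rcases hy with rfl | rfl | rfl <;>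
        first | exact (hxy rfl).elim | assumption | (rw [G.adj_comm]; assumption)
    · rw [hcard, ← h3]
      exact hQ.card_le s hs
  have hTst : ∀ {a y y'}, a ∈ ({a₁, a₂, a₃} : Finset V) → y ∉ ({a₁, a₂, a₃} : Finset V) →
      y' ∉ ({a₁, a₂, a₃} : Finset V) → G.Adj a y → G.Adj a y' → ¬ G.Adj y y' :=
    fun ha hy hy' e e' => hT.not_adj_of_attachedTo_same h ⟨ha, hy, e⟩ ⟨ha, hy', e'⟩
  have hTun : ∀ {a a' y}, a ∈ ({a₁, a₂, a₃} : Finset V) → a' ∈ ({a₁, a₂, a₃} : Finset V) →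
      a ≠ a' → y ∉ ({a₁, a₂, a₃} : Finset V) → G.Adj a y → ¬ G.Adj a' y :=
    fun ha ha' hne hy e e' => hne (hT.attachedTo_unique hd ⟨ha, hy, e⟩ ⟨ha', hy, e'⟩)
  have m1 : a₁ ∈ ({a₁, a₂, a₃} : Finset V) := by simp
  have m2 : a₂ ∈ ({a₁, a₂, a₃} : Finset V) := by simp
  have m3 : a₃ ∈ ({a₁, a₂, a₃} : Finset V) := by simp
  have mem : ∀ {y}, y ≠ a₁ → y ≠ a₂ → y ≠ a₃ → y ∉ ({a₁, a₂, a₃} : Finset V) := by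
    intro y h1 h2 h3
    simp [h1, h2, h3]
  have hxT := mem hxa (hne h12 hx ha₂) (hne h13 hx ha₃)
  have hx1 : ¬ G.Adj a₁ x := hst ha₁ hx
  have hx3 : ¬ G.Adj a₃ x := hTun m2 m3 e23.ne hxT hx2.symm
  -- the vertex attached to `q₃` and `a₁`
  obtain ⟨z, hz, hxz⟩ := hQ.exists_adj_attachedTo h h3 hx ha₃.1 h13.symm
  have hza : z ≠ a₃ := fun e => hx3 (e ▸ hxz.symm)
  have hzT := mem (hne h13.symm hz ha₁) (hne h23.symm hz ha₂) hza
  have hz3 : ¬ G.Adj a₃ z := hst ha₃ hz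
  have hz2 : ¬ G.Adj a₂ z := fun e => hTst m2 hxT hzT hx2.symm e hxz
  have hz1 : G.Adj a₁ z :=
    ((hQ.adj_or_adj h h13.symm h23.symm h12 hz ha₁ ha₂ e12).resolve_right fun e => hz2 e.symm).symm
  -- the vertex attached to `q₂` and `a₃`
  obtain ⟨w, hw, hzw⟩ := hQ.exists_adj_attachedTo h h3 hz ha₂.1 h23
  have hwa : w ≠ a₂ := fun e => hz2 (e ▸ hzw.symm)
  have hwT := mem (hne h12.symm hw ha₁) hwa (hne h23 hw ha₃)
  have hw2 : ¬ G.Adj a₂ w := hst ha₂ hw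
  have hw1 : ¬ G.Adj a₁ w := fun e => hTst m1 hzT hwT hz1 e hzw
  have hw3 : G.Adj a₃ w :=
    ((hQ.adj_or_adj h h12.symm h23 h13 hw ha₁ ha₃ e13).resolve_left fun e => hw1 e.symm).symm
  have hxw : G.Adj x w :=
    (hQ.adj_or_adj h h12 h13 h23 hx hw ha₃ hw3.symm).resolve_right fun e => hx3 e.symm
  -- no further vertex is attached
  have huniq : ∀ {p₁ p₂ p₃ b₁ b₂ b₃ s t r : V}, p₁ ≠ p₂ → p₁ ≠ p₃ → p₂ ≠ p₃ →
      b₁ ∈ ({a₁, a₂, a₃} : Finset V) → b₂ ∈ ({a₁, a₂, a₃} : Finset V) →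
      b₃ ∈ ({a₁, a₂, a₃} : Finset V) → s ∉ ({a₁, a₂, a₃} : Finset V) →
      t ∉ ({a₁, a₂, a₃} : Finset V) → r ∉ ({a₁, a₂, a₃} : Finset V) →
      G.AttachedTo Q p₁ b₁ → G.AttachedTo Q p₂ b₂ → G.AttachedTo Q p₃ b₃ →
      G.AttachedTo Q p₁ s → G.AttachedTo Q p₂ t → G.AttachedTo Q p₃ r →
      G.Adj b₂ s → G.Adj b₃ t → G.Adj b₁ r → G.Adj s t → G.Adj t r → G.Adj s r →
      ∀ y, G.AttachedTo Q p₁ y → y ∉ ({a₁, a₂, a₃} : Finset V) → y = s := by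
    intro p₁ p₂ p₃ b₁ b₂ b₃ s t r h12 h13 h23 m1 m2 m3 hsT htT hrT hb₁ hb₂ hb₃ hs ht hr
      hbs hbt hbr hst' htr hsr y hy hyT
    have n12 := hne h12 hb₁ hb₂
    have n13 := hne h13 hb₁ hb₃
    have n23 := hne h23 hb₂ hb₃
    have hr2 := hTun m1 m2 n12 hrT hbr
    -- If `y` is adjacent to `b₂`, then `y` and `s` are both adjacent to the ends of the edge `t r`,
    -- so they coincide. If not, `y` has a neighbor `p` making `r, s, p₁, y, p` an induced `P₅`.
    by_cases hy2 : G.Adj y b₂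
    · have hyr : G.Adj y r := ((hQ.adj_or_adj h h13.symm h23.symm h12 hr hy hb₂ hy2).resolve_right
        fun e => hr2 e.symm).symm
      have hy3 : ¬ G.Adj y b₃ := fun e => hTun m2 m3 n23 hyT hy2.symm e.symm
      have hyt := (hQ.adj_or_adj h h12 h13 h23 hy ht hb₃ hbt.symm).resolve_right hy3
      by_contra hys
      exact hst hy hs (hd.adj_of_common_neighbors htr hyt hyr hst' hsr hys)
    · exfalso
      have hy3 : G.Adj y b₃ := (hQ.adj_or_adj h h12 h13 h23 hy hb₂ hb₃
        (hT.isClique m2 m3 n23)).resolve_left hy2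
      obtain ⟨p, hp, hyp⟩ := hQ.exists_adj_attachedTo h h3 hy hb₂.1 h12.symm
      have hpT : p ∉ ({a₁, a₂, a₃} : Finset V) := by
        intro hpT
        exact hT.not_adj_of_ne hd ⟨m3, hyT, hy3.symm⟩ hpT (hne h23 hp hb₃) hyp.symm
      have hp3 : ¬ G.Adj b₃ p := fun e => hTst m3 hyT hpT hy3.symm e hyp
      have hp1 : G.Adj b₁ p := ((hQ.adj_or_adj h h12.symm h23 h13 hp hb₁ hb₃
        (hT.isClique m1 m3 n13)).resolve_right fun e => hp3 e.symm).symm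
      have hrp : ¬ G.Adj r p := hTst m1 hrT hpT hbr hp1
      have hry : ¬ G.Adj r y := by
        intro e
        rcases hQ.adj_or_adj h h12.symm h23 h13 hb₂ hy hr e.symm with e' | e'
        · exact hy2 e'.symm
        · exact hr2 e'
      have hsp : ¬ G.Adj s p := by
        intro e
        rcases hQ.adj_or_adj h h13.symm h23.symm h12 hb₃ hs hp e with e' | e'
        · exact hTun m2 m3 n23 hsT hbs e'
        · exact hp3 e'
      exact h.pathFree.false_of_path hsr.symm hs.2.2.symm hy.2.2 hyp
        (fun e => hQ.not_adj_of_ne hd hr hy.1 h13 e.symm) hry hrp (hst hs hy) hsp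
        (hQ.not_adj_of_ne hd hp hy.1 h12)
  have hcover : ∀ v, v ∈ ({q₁, q₂, q₃, a₁, a₂, a₃, x, z, w} : Finset V) := by
    intro v
    simp only [Finset.mem_insert, Finset.mem_singleton]
    rcases hQ.mem_or_attachedTo h v with hv | ⟨q, hq⟩
    · rcases eq_or_eq_or_eq h3 ha₁.1 ha₂.1 ha₃.1 h12 h13 h23 hv with e | e | e <;> simp [e]
    by_cases hvT : v ∈ ({a₁, a₂, a₃} : Finset V)
    · simp only [Finset.mem_insert, Finset.mem_singleton] at hvT
      rcases hvT with e | e | e <;> simp [e]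
    rcases eq_or_eq_or_eq h3 ha₁.1 ha₂.1 ha₃.1 h12 h13 h23 hq.1 with rfl | rfl | rfl
    · have := huniq h12 h13 h23 m1 m2 m3 hxT hwT hzT ha₁ ha₂ ha₃ hx hw hz hx2.symm hw3 hz1 hxw
        hzw.symm hxz v hq hvT
      simp [this]
    · have := huniq h23 h12.symm h13.symm m2 m3 m1 hwT hzT hxT ha₂ ha₃ ha₁ hw hz hx hw3 hz1
        hx2.symm hzw.symm hxz.symm hxw.symm v hq hvT
      simp [this]
    · have := huniq h13.symm h23.symm h12 m3 m1 m2 hzT hxT hwT ha₃ ha₁ ha₂ hz hx hw hz1 hx2.symm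
        hw3 hxz.symm hxw hzw v hq hvT
      simp [this]
  have nq : ∀ {q q' a}, G.AttachedTo Q q a → q' ∈ Q → q' ≠ q → ¬ G.Adj q' a :=
    fun ha hq' hne => hQ.not_adj_of_ne hd ha hq' hne
  have f12 := hQ.isClique ha₁.1 ha₂.1 h12
  have f13 := hQ.isClique ha₁.1 ha₃.1 h13
  have f23 := hQ.isClique ha₂.1 ha₃.1 h23
  -- Residues modulo 3 give the three triangles, whose edges are the steps `3`; the steps `1` are
  -- the edges between different triangles.
  let f : Fin 9 → V := ![q₁, a₁, z, q₃, a₃, w, q₂, a₂, x]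
  have hlt : ∀ i j : Fin 9, i < j → (G.Adj (f i) (f j) ↔ CirculantAdj i j) := by
    have n1 := nq hz ha₁.1 h13
    have n2 := nq ha₃ ha₁.1 h13
    have n3 := nq hw ha₁.1 h12
    have n4 := nq ha₂ ha₁.1 h12
    have n5 := nq ha₁ ha₃.1 h13.symm
    have n6 := nq ha₁ ha₂.1 h12.symm
    have n7 := nq hz ha₂.1 h23
    have n8 := nq hw ha₃.1 h23.symm
    have n9 := nq ha₂ ha₃.1 h23.symm
    have n10 := nq hx ha₃.1 h13.symm
    have n11 := nq ha₃ ha₂.1 h23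
    have n12 := nq hx ha₂.1 h12.symm
    have p1 := ha₁.2.2
    have p2 := hx.2.2
    have p3 := hz.2.2
    have p4 := ha₃.2.2
    have p5 := hw.2.2
    have p6 := ha₂.2.2
    have hf : f = ![q₁, a₁, z, q₃, a₃, w, q₂, a₂, x] := rfl
    have key : ∀ i j : Fin 9, i < j → if CirculantAdj i j then G.Adj (f i) (f j) else
        ¬ G.Adj (f i) (f j) := by
      rw [hf]
      intro i j hij
      fin_cases i <;> fin_cases j <;>
        first
        | exact absurd hij (by decide)
        | (rw [if_pos (by decide)]; first | assumption | (rw [G.adj_comm]; assumption))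
        | (rw [if_neg (by decide)]; first | assumption | (rw [G.adj_comm]; assumption))
    intro i j hij
    have := key i j hij
    split_ifs at this with hc
    · exact iff_of_true this hc
    · exact iff_of_false this hc
  refine ⟨f, ?_, ?_⟩
  · intro v
    have := hcover v
    simp only [Finset.mem_insert, Finset.mem_singleton] at this
    rcases this with rfl | rfl | rfl | rfl | rfl | rfl | rfl | rfl | rfl
    exacts [⟨0, rfl⟩, ⟨6, rfl⟩, ⟨3, rfl⟩, ⟨1, rfl⟩, ⟨7, rfl⟩, ⟨4, rfl⟩, ⟨8, rfl⟩, ⟨2, rfl⟩,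
      ⟨5, rfl⟩]
  · intro i j
    rcases lt_trichotomy i j with hij | rfl | hij
    · exact hlt i j hij
    · have : ¬ CirculantAdj i i := by
        revert i
        decide
      exact ⟨fun e => (G.loopless.irrefl _ e).elim, fun e => (this e).elim⟩
    · rw [G.adj_comm, hlt j i hij]
      revert i j
      decide

/-- For `|Q| = 3`, take a triangle of attached vertices. A further vertex in any class is adjacent
to one of the two triangle vertices of the other classes, which up to relabeling is the situation of
`exists_circulant`; with no further vertex the graph is a prism. -/
theorem isCliquePrism_or_exists_circulant : G.IsCliquePrism Q ∨
    ∃ f : Fin 9 → V, Function.Surjective f ∧ ∀ i j, G.Adj (f i) (f j) ↔ CirculantAdj i j := by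
  classical
  by_cases h4 : 4 ≤ Q.card
  · exact .inl (hQ.isCliquePrism_of_four_le h h4)
  have h3 : Q.card = 3 := by
    have := hQ.three_le
    omega
  by_cases hpr : G.IsCliquePrism Q
  · exact .inl hpr
  right
  have hd := h.diamondFree
  have hmain : ∀ {q₁ q₂ q₃ a₁ a₂ a₃ x}, q₁ ≠ q₂ → q₁ ≠ q₃ → q₂ ≠ q₃ → G.AttachedTo Q q₁ a₁ →
      G.AttachedTo Q q₂ a₂ → G.AttachedTo Q q₃ a₃ → G.Adj a₁ a₂ → G.Adj a₂ a₃ → G.Adj a₁ a₃ →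
      G.AttachedTo Q q₁ x → x ≠ a₁ →
      ∃ f : Fin 9 → V, Function.Surjective f ∧ ∀ i j, G.Adj (f i) (f j) ↔ CirculantAdj i j := by
    intro q₁ q₂ q₃ a₁ a₂ a₃ x h12 h13 h23 ha₁ ha₂ ha₃ e12 e23 e13 hx hxa
    rcases hQ.adj_or_adj h h12 h13 h23 hx ha₂ ha₃ e23 with e | e
    · exact hQ.exists_circulant h h3 h12 h13 h23 ha₁ ha₂ ha₃ e12 e23 e13 hx hxa e
    · exact hQ.exists_circulant h h3 h13 h12 h23.symm ha₁ ha₃ ha₂ e13 e23.symm e12 hx hxa e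
  obtain ⟨q₁, q₂, q₃, h12, h13, h23, rfl⟩ := Finset.card_eq_three.1 h3
  have m1 : q₁ ∈ ({q₁, q₂, q₃} : Finset V) := by simp
  have m2 : q₂ ∈ ({q₁, q₂, q₃} : Finset V) := by simp
  have m3 : q₃ ∈ ({q₁, q₂, q₃} : Finset V) := by simp
  obtain ⟨a₁, a₂, a₃, ha₁, ha₂, ha₃, e12, e23, e13⟩ :=
    hQ.exists_attached_triangle h h3 m1 m2 m3 h12 h13 h23
  by_contra hcon
  have hu : ∀ {q a}, G.AttachedTo {q₁, q₂, q₃} q a →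
      q = q₁ ∧ a = a₁ ∨ q = q₂ ∧ a = a₂ ∨ q = q₃ ∧ a = a₃ := by
    intro q a ha
    rcases eq_or_eq_or_eq h3 m1 m2 m3 h12 h13 h23 ha.1 with rfl | rfl | rfl
    · exact .inl ⟨rfl, by_contra fun e =>
        hcon (hmain h12 h13 h23 ha₁ ha₂ ha₃ e12 e23 e13 ha e)⟩
    · exact .inr (.inl ⟨rfl, by_contra fun e =>
        hcon (hmain h23 h12.symm h13.symm ha₂ ha₃ ha₁ e23 e13.symm e12.symm ha e)⟩)
    · exact .inr (.inr ⟨rfl, by_contra fun e =>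
        hcon (hmain h13.symm h23.symm h12 ha₃ ha₁ ha₂ e13.symm e12 e23.symm ha e)⟩)
  refine hpr ⟨fun {i a a'} ha ha' => ?_, fun {i j a b} hij ha hb => ?_⟩
  · rcases hu ha with ⟨r, s⟩ | ⟨r, s⟩ | ⟨r, s⟩ <;>
      rcases hu ha' with ⟨r', s'⟩ | ⟨r', s'⟩ | ⟨r', s'⟩
    all_goals
      have e := r.symm.trans r'
      first
      | exact s.trans s'.symm
      | exact absurd e ‹_›
      | exact absurd e.symm ‹_›
  · rcases hu ha with ⟨r, s⟩ | ⟨r, s⟩ | ⟨r, s⟩ <;>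
      rcases hu hb with ⟨r', s'⟩ | ⟨r', s'⟩ | ⟨r', s'⟩
    all_goals
      rw [s, s']
      first
      | exact (hij (r.trans r'.symm)).elim
      | assumption
      | (rw [G.adj_comm]; assumption)

end IsLargeMaxClique

/-! ### Color classes of the prism and of the circulant graph -/

theorem Coloring.colorable_induce_compl {W : Type u} [Fintype W] {m : ℕ}
    (hW : Fintype.card W = m + 1) (γ : G.Coloring W) (c : W) {S : Set V}
    (hS : ∀ v, γ v = c ↔ v ∈ S) : (G.induce Sᶜ).Colorable m := by
  classical
  let δ : (G.induce Sᶜ).Coloring {x : W // x ≠ c} :=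
    Coloring.mk (fun v => ⟨γ v, fun e => v.2 ((hS v).1 e)⟩)
      (fun h e => γ.valid h (congrArg Subtype.val e))
  have hcard : Fintype.card {x : W // x ≠ c} = m := by
    rw [Fintype.card_subtype_compl, hW, Fintype.card_subtype_eq]
    rfl
  exact hcard ▸ δ.colorable

/-- Such a permutation describes a `|Q|`-coloring of the prism: `q` gets color `q` and its partner
gets `σ q`, so `i` shares its color with the partner of `j`. -/
theorem exists_perm_forall_ne {W : Type u} [Fintype W] {i j : W} (hij : i ≠ j) :
    ∃ σ : Equiv.Perm W, (∀ x, σ x ≠ x) ∧ σ j = i := by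
  classical
  obtain ⟨n, hn⟩ : ∃ n, Fintype.card W = n + 2 := by
    have := Fintype.one_lt_card_iff.2 ⟨i, j, hij⟩
    exact ⟨Fintype.card W - 2, by omega⟩
  let e : W ≃ Fin (n + 2) := Fintype.equivFinOfCardEq hn
  let τ : Equiv.Perm W := (e.trans (finRotate (n + 2))).trans e.symm
  have hτ : ∀ x, τ x ≠ x := by
    intro x hx
    have h1 : finRotate (n + 2) (e x) = e x := (Equiv.symm_apply_eq e).1 hx
    rw [finRotate_apply] at h1
    exact one_ne_zero (add_eq_left.1 h1)
  -- conjugate by a permutation that fixes `j` and maps `τ j` to `i`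
  let ρ : Equiv.Perm W := Equiv.swap (τ j) i
  have hρj : ρ j = j := Equiv.swap_apply_of_ne_of_ne (hτ j).symm hij.symm
  refine ⟨(ρ.symm.trans τ).trans ρ, fun x hx => hτ (ρ.symm x) ?_, ?_⟩
  · exact (Equiv.eq_symm_apply ρ).2 hx
  · have : ρ.symm j = j := (Equiv.symm_apply_eq ρ).2 hρj.symm
    change ρ (τ (ρ.symm j)) = i
    rw [this]
    exact Equiv.swap_apply_left _ _

section

variable {m : ℕ} {C : Type} [Finite C]

namespace IsCliquePrism

variable {Q : Finset V} (hP : G.IsCliquePrism Q) (hQ : G.IsLargeMaxClique Q)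
  (h : G.IsReduced (m + 1))
include hP hQ h

theorem exists_coloring {i j b : V} (hi : i ∈ Q) (hb : G.AttachedTo Q j b) (hij : i ≠ j) :
    ∃ γ : G.Coloring Q, ∀ v, γ v = ⟨i, hi⟩ ↔ v ∈ ({i, b} : Set V) := by
  classical
  obtain ⟨σ, hσ, hσj⟩ := exists_perm_forall_ne (W := Q) (i := ⟨i, hi⟩) (j := ⟨j, hb.1⟩)
    (fun e => hij (congrArg Subtype.val e))
  have hg : ∀ v, ∃ x : Q, (∀ hv : v ∈ Q, x = ⟨v, hv⟩) ∧
      ∀ q (hq : G.AttachedTo Q q v), x = σ ⟨q, hq.1⟩ := by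
    intro v
    rcases hQ.mem_or_attachedTo h v with hv | ⟨q, hq⟩
    · exact ⟨⟨v, hv⟩, fun _ => rfl, fun q hq => (hq.2.1 hv).elim⟩
    · refine ⟨σ ⟨q, hq.1⟩, fun hv => (hq.2.1 hv).elim, fun q' hq' => ?_⟩
      have := hQ.attachedTo_unique h.diamondFree hq hq'
      subst this
      rfl
  choose g hg1 hg2 using hg
  refine ⟨Coloring.mk g ?_, fun v => ?_⟩
  · intro v w hvw e
    rcases hQ.mem_or_attachedTo h v with hv | ⟨q, hq⟩ <;>
      rcases hQ.mem_or_attachedTo h w with hw | ⟨p, hp⟩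
    · rw [hg1 v hv, hg1 w hw] at e
      exact hvw.ne (congrArg Subtype.val e)
    · have hvp : v = p := by
        by_contra hne
        exact hQ.not_adj_of_ne h.diamondFree hp hv hne hvw
      subst hvp
      rw [hg1 v hv, hg2 w v hp] at e
      exact hσ _ e.symm
    · have hwq : w = q := by
        by_contra hne
        exact hQ.not_adj_of_ne h.diamondFree hq hw hne hvw.symm
      subst hwq
      rw [hg1 w hw, hg2 v w hq] at e
      exact hσ _ e
    · rw [hg2 v q hq, hg2 w p hp] at e
      have hqp : q = p := congrArg Subtype.val (σ.injective e)
      subst hqp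
      exact hvw.ne (hP.unique hq hp)
  · change g v = _ ↔ v = i ∨ v = b
    rcases hQ.mem_or_attachedTo h v with hv | ⟨q, hq⟩
    · rw [hg1 v hv, Subtype.mk.injEq]
      exact ⟨.inl, fun e => e.resolve_right fun e => hb.2.1 (e ▸ hv)⟩
    · rw [hg2 v q hq, ← hσj, σ.injective.eq_iff, Subtype.mk.injEq]
      constructor
      · rintro rfl
        exact .inr (hP.unique hq hb)
      · rintro (rfl | rfl)
        · exact (hq.2.1 hi).elim
        · exact hQ.attachedTo_unique h.diamondFree hq hb

/-- Each of the two cliques shows `|Q|` colors, but there are only `|Q| + 1 < 2|Q|` in all, so some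
color is shared. Its class meets each clique once. -/
theorem exists_colorClass (hC : Nat.card C = m + 2) (hm : m + 1 = Q.card) (α : G.Coloring C) :
    ∃ i j b c, i ∈ Q ∧ G.AttachedTo Q j b ∧ i ≠ j ∧ ∀ v, α v = c ↔ v ∈ ({i, b} : Set V) := by
  classical
  have := Fintype.ofFinite C
  rw [Nat.card_eq_fintype_card] at hC
  have hf : ∀ q, ∃ b, q ∈ Q → G.AttachedTo Q q b := by
    intro q
    by_cases hq : q ∈ Q
    · obtain ⟨b, hb⟩ := hQ.exists_attachedTo h hq
      exact ⟨b, fun _ => hb⟩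
    · exact ⟨q, fun h => (hq h).elim⟩
  choose f hf using hf
  obtain ⟨i, hi, j, hj, hij⟩ : ∃ i ∈ Q, ∃ j ∈ Q, α i = α (f j) := by
    by_contra hcon
    push Not at hcon
    have h1 : (Q.image α).card = Q.card := Finset.card_image_of_injOn fun x hx y hy e => by
      by_contra hne
      exact α.valid (hQ.isClique hx hy hne) e
    have h2 : (Q.image fun q => α (f q)).card = Q.card :=
      Finset.card_image_of_injOn fun x hx y hy e => by
        by_contra hne
        exact α.valid (hP.adj hne (hf x hx) (hf y hy)) e
    have h3 : Disjoint (Q.image α) (Q.image fun q => α (f q)) := by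
      rw [Finset.disjoint_left]
      intro c hc hc'
      obtain ⟨i, hi, rfl⟩ := Finset.mem_image.1 hc
      obtain ⟨j, hj, e⟩ := Finset.mem_image.1 hc'
      exact hcon i hi j hj e.symm
    have h4 := Finset.card_le_univ (Q.image α ∪ Q.image fun q => α (f q))
    rw [Finset.card_union_of_disjoint h3] at h4
    have := hQ.three_le
    omega
  refine ⟨i, j, f j, α i, hi, hf j hj, ?_, fun v => ⟨fun hv => ?_, ?_⟩⟩
  · rintro rfl
    exact α.valid (hf i hi).2.2 hij
  · rcases hQ.mem_or_attachedTo h v with hv' | ⟨q, hq⟩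
    · left
      by_contra hne
      exact α.valid (hQ.isClique hv' hi hne) hv
    · right
      by_cases hqj : q = j
      · exact hP.unique (hqj ▸ hq) (hf j hj)
      · exact (α.valid (hP.adj hqj hq (hf j hj)) (hv.trans hij)).elim
  · rintro (rfl | rfl)
    · rfl
    · exact hij.symm

theorem recolorEquiv [Finite V] (hC : Nat.card C = m + 2)
    (hmix : ∀ T : Set V, T ≠ Set.univ → (G.induce T).MixingAbove) (α β : G.Coloring C) :
    RecolorEquiv α β := by
  classical
  have hd := h.diamondFree
  obtain ⟨q, hq⟩ := Finset.card_pos.1 (lt_of_lt_of_le (by norm_num) hQ.three_le)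
  obtain ⟨p, hp, hpq, -⟩ := hQ.exists_ne_ne q q
  obtain ⟨b, hb⟩ := hQ.exists_attachedTo h hp
  by_cases hm : G.Colorable m
  · exact equiv_of_colorable_of_adj hC hmix hm hb.2.2 α β
  have hcard : m + 1 = Q.card := by
    have h1 := h.card_clique_le hQ.isClique
    obtain ⟨γ, -⟩ := hP.exists_coloring hQ h hq hb hpq.symm
    have h2 := γ.colorable
    rw [Fintype.card_coe] at h2
    by_contra hne
    exact hm (h2.mono (by omega))
  have hgood : ∀ {i j b}, i ∈ Q → G.AttachedTo Q j b → i ≠ j →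
      (G.induce ({i, b} : Set V)ᶜ).Colorable m := by
    intro i j b hi hb hij
    obtain ⟨γ, hγ⟩ := hP.exists_coloring hQ h hi hb hij
    exact γ.colorable_induce_compl (by rw [Fintype.card_coe, hcard]) _ hγ
  obtain ⟨i, j, b, c, hi, hb, hij, hα⟩ := hP.exists_colorClass hQ h hC hcard α
  obtain ⟨i', j', b', c', hi', hb', hij', hβ⟩ := hP.exists_colorClass hQ h hC hcard β
  have hdis : ∀ {i j b i' j' b'}, i ∈ Q → G.AttachedTo Q j b → i' ∈ Q → G.AttachedTo Q j' b' →
      i ≠ i' → j ≠ j' → Disjoint ({i, b} : Set V) {i', b'} := by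
    intro i j b i' j' b' hi hb hi' hb' hii' hjj'
    rw [Set.disjoint_left]
    rintro v (rfl | rfl) (e | e)
    · exact hii' e
    · exact hb'.2.1 (e ▸ hi)
    · exact hb.2.1 (e ▸ hi')
    · exact hjj' (hQ.attachedTo_unique hd hb (e ▸ hb'))
  have hcommon : ∀ p r, p ∈ Q → r ∈ Q → p ≠ r → i ≠ p → i' ≠ p → j ≠ r → j' ≠ r →
      RecolorEquiv α β := by
    intro p r hp hr hpr h1 h2 h3 h4
    obtain ⟨a, ha⟩ := hQ.exists_attachedTo h hr
    refine equiv_of_common_disjoint hC hmix (Set.insert_nonempty _ _) (Set.insert_nonempty _ _)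
      (T := {p, a}) (Set.insert_nonempty _ _) (hgood hi hb hij) (hgood hi' hb' hij')
      (hgood hp ha hpr) ?_ hα hβ (hdis hi hb hp ha h1 h3) (hdis hi' hb' hp ha h2 h4)
    have hpa := hQ.not_adj_of_ne hd ha hp hpr
    rintro v (rfl | rfl) w (rfl | rfl) hvw
    · exact hvw.ne rfl
    · exact hpa hvw
    · exact hpa hvw.symm
    · exact hvw.ne rfl
  -- The pairs for `(i, j)` and `(i', j')` are disjoint if both coordinates differ. Otherwise three
  -- elements of `Q` suffice to find a pair `(p, r)` disjoint from both; with both coordinates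
  -- different and `|Q| = 3` none need exist.
  by_cases hii' : i = i'
  · obtain ⟨r, hr, hrj, hrj'⟩ := hQ.exists_ne_ne j j'
    obtain ⟨p, hp, hpi, hpr⟩ := hQ.exists_ne_ne i r
    exact hcommon p r hp hr hpr hpi.symm (hii' ▸ hpi.symm) hrj.symm hrj'.symm
  by_cases hjj' : j = j'
  · obtain ⟨p, hp, hpi, hpi'⟩ := hQ.exists_ne_ne i i'
    obtain ⟨r, hr, hrj, hrp⟩ := hQ.exists_ne_ne j p
    exact hcommon p r hp hr hrp.symm hpi.symm hpi'.symm hrj.symm (hjj' ▸ hrj.symm)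
  exact equiv_of_disjoint_colorClasses hC hmix (Set.insert_nonempty _ _) (Set.insert_nonempty _ _)
    (hgood hi hb hij) (hgood hi' hb' hij') hα hβ (hdis hi hb hi' hb' hii' hjj')

end IsCliquePrism

/-- The stable set `{0, 2, 4}` of the circulant graph. -/
abbrev CirculantTriple (i : Fin 9) : Prop := i = 0 ∨ i = 2 ∨ i = 4

/-- The graph is 3-colorable, so only `m = 2` is left. With four colors on nine vertices some class
has three vertices, and the stable triples are exactly the translates of `{0, 2, 4}`, each maximal
stable with bipartite complement. -/
theorem recolorEquiv_of_circulant [Finite V] (hC : Nat.card C = m + 2)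
    (hmix : ∀ T : Set V, T ≠ Set.univ → (G.induce T).MixingAbove) (hm : 2 ≤ m)
    {f : Fin 9 → V} (hf : Function.Surjective f)
    (hadj : ∀ i j, G.Adj (f i) (f j) ↔ CirculantAdj i j) (α β : G.Coloring C) :
    RecolorEquiv α β := by
  classical
  have htwin : ∀ i j : Fin 9, (∀ k, CirculantAdj i k ↔ CirculantAdj j k) → i = j := by decide
  have hinj : Function.Injective f := fun i j e => htwin i j fun k => by
    rw [← hadj, ← hadj, e]
  obtain ⟨g, hg⟩ : ∃ g : V → Fin 9, ∀ v, f (g v) = v := ⟨_, Function.surjInv_eq hf⟩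
  have hgf : ∀ i, g (f i) = i := fun i => hinj (hg _)
  have hadj' : ∀ {v w}, G.Adj v w → CirculantAdj (g v) (g w) := by
    intro v w hvw
    rwa [← hadj, hg, hg]
  have h3 : G.Colorable 3 := by
    let d : Fin 9 → Fin 3 := ![0, 1, 2, 1, 2, 0, 2, 0, 1]
    have hd : ∀ i j, CirculantAdj i j → d i ≠ d j := by decide
    exact ⟨Coloring.mk (fun v => d (g v)) fun hvw => hd _ _ (hadj' hvw)⟩
  by_cases hm3 : 3 ≤ m
  · exact equiv_of_colorable_of_adj hC hmix (h3.mono hm3) ((hadj 0 1).2 (by decide)) α β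
  obtain rfl : m = 2 := by omega
  let T : Fin 9 → Set V := fun t => {v | CirculantTriple (g v - t)}
  have hTne : ∀ t, (T t).Nonempty := fun t => ⟨f t, by
    change CirculantTriple (g (f t) - t)
    rw [hgf, sub_self]
    exact .inl rfl⟩
  have hTst : ∀ t, ∀ v ∈ T t, ∀ w ∈ T t, ¬ G.Adj v w := by
    have : ∀ t i j : Fin 9, CirculantTriple (i - t) → CirculantTriple (j - t) →
        ¬ CirculantAdj i j := by decide
    exact fun t v hv w hw hvw => this t _ _ hv hw (hadj' hvw)
  have hcol : ∀ t, (G.induce (T t)ᶜ).Colorable 2 := by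
    intro t
    -- A 2-coloring of the complement of `{0, 2, 4}`; the entries at these three positions are
    -- irrelevant.
    let d : Fin 9 → Fin 2 := ![0, 1, 0, 0, 0, 0, 1, 0, 1]
    have hd : ∀ t i j : Fin 9, ¬ CirculantTriple (i - t) → ¬ CirculantTriple (j - t) →
        CirculantAdj i j → d (i - t) ≠ d (j - t) := by decide
    exact ⟨Coloring.mk (fun v => d (g v - t)) fun {v w} hvw => hd t _ _ v.2 w.2 (hadj' hvw)⟩
  have hclass : ∀ α : G.Coloring C, ∃ t c, ∀ v, α v = c ↔ v ∈ T t := by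
    intro α
    have := Fintype.ofFinite C
    have hC' := hC
    rw [Nat.card_eq_fintype_card] at hC'
    obtain ⟨c, -, hc⟩ := Finset.exists_lt_card_fiber_of_mul_lt_card_of_maps_to
      (s := (Finset.univ : Finset (Fin 9))) (t := (Finset.univ : Finset C)) (f := fun i => α (f i))
      (n := 2) (fun _ _ => Finset.mem_univ _) (by
        rw [Finset.card_univ, Finset.card_univ, hC', Fintype.card_fin]
        norm_num)
    obtain ⟨i, j, l, hi, hj, hl, hij, hil, hjl⟩ := Finset.two_lt_card_iff.1 hc
    simp only [Finset.mem_filter, Finset.mem_univ, true_and] at hi hj hl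
    have hn : ∀ {x y}, α (f x) = c → α (f y) = c → ¬ CirculantAdj x y := fun hx hy e =>
      α.valid ((hadj _ _).2 e) (hx.trans hy.symm)
    have hdec : ∀ i j l : Fin 9, i ≠ j → i ≠ l → j ≠ l → ¬ CirculantAdj i j → ¬ CirculantAdj i l →
        ¬ CirculantAdj j l → ∃ t, ∀ x, CirculantTriple (x - t) ↔ x = i ∨ x = j ∨ x = l := by
      decide
    obtain ⟨t, ht⟩ := hdec i j l hij hil hjl (hn hi hj) (hn hi hl) (hn hj hl)
    refine ⟨t, c, fun v => ⟨fun hv => ?_, fun hv => ?_⟩⟩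
    · by_contra hvT
      -- Maximality of the triple shows that the color class contains no fourth vertex.
      have hmax : ∀ t x : Fin 9, ¬ CirculantTriple (x - t) →
          ∃ y, CirculantTriple (y - t) ∧ CirculantAdj x y := by decide
      obtain ⟨y, hy, hxy⟩ := hmax t (g v) hvT
      have hyc : α (f y) = c := by
        rcases (ht y).1 hy with rfl | rfl | rfl <;> assumption
      exact hn (by rwa [hg]) hyc hxy
    · rw [← hg v]
      rcases (ht (g v)).1 hv with e | e | e <;> rw [e] <;> assumption
  obtain ⟨t, c, hα⟩ := hclass α
  obtain ⟨t', c', hβ⟩ := hclass β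
  have hdec : ∀ t t' : Fin 9, (∀ x, CirculantTriple (x - t) → ¬ CirculantTriple (x - t')) ∨
      ∃ s, ∀ x, CirculantTriple (x - s) → ¬ CirculantTriple (x - t) ∧
        ¬ CirculantTriple (x - t') := by decide
  rcases hdec t t' with hdis | ⟨s, hs⟩
  · exact equiv_of_disjoint_colorClasses hC hmix (hTne t) (hTne t') (hcol t) (hcol t') hα hβ
      (Set.disjoint_left.2 fun v hv => hdis _ hv)
  · exact equiv_of_common_disjoint hC hmix (hTne t) (hTne t') (hTne s) (hcol t) (hcol t') (hcol s)
      (hTst s) hα hβ (Set.disjoint_right.2 fun v hv => (hs _ hv).1)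
      (Set.disjoint_right.2 fun v hv => (hs _ hv).2)

end

/-! ### The induction on the number of vertices -/

theorem mixingAbove_of_indFree (n : ℕ) : ∀ (V : Type u) [Finite V] (G : SimpleGraph V),
    Nat.card V < n → G.IndFree (pathGraph 5) → G.IndFree diamond → G.MixingAbove := by
  induction n with
  | zero => exact fun V _ G h => (Nat.not_lt_zero _ h).elim
  | succ n ih =>
    intro V _ G hn hp hd k C _ hC hk α β
    have hmix : ∀ T : Set V, T ≠ Set.univ → (G.induce T).MixingAbove := by
      intro T hT
      obtain ⟨x, hx⟩ := (Set.ne_univ_iff_exists_notMem T).1 hT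
      have : Nat.card T < Nat.card V := Finite.card_subtype_lt hx
      exact ih T _ (by omega) (hp.induce T) (hd.induce T)
    by_contra hcon
    have hne : ∀ x : V, ({x}ᶜ : Set V) ≠ Set.univ := fun x e =>
      (e ▸ Set.mem_univ x : x ∈ ({x}ᶜ : Set V)) rfl
    -- Any failing condition triggers one of the three reductions, which would join `α` and `β`.
    have h : G.IsReduced k := by
      refine ⟨hk, hp, hd, fun x y hxy hadj => ?_, fun x s hs => ?_, fun S hS hcl => ?_⟩
      · by_contra hno
        push Not at hno
        exact hcon (equiv_of_neighbors_subset hC hk hxy hadj hno (hmix _ (hne x)) α β)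
      · by_contra hlt
        exact hcon (equiv_of_degree_lt hC hk s hs (not_le.1 hlt) (hmix _ (hne x)) α β)
      · by_contra hS'
        refine hcon (equiv_of_closed hC hk S hcl (hmix _ hS') (hmix _ ?_) α β)
        obtain ⟨x, hx⟩ := hS
        exact fun e => (e ▸ Set.mem_univ x : x ∈ Sᶜ) hx
    rcases isEmpty_or_nonempty V with hV | ⟨⟨v⟩⟩
    · exact hcon (.of_eq fun v => hV.elim v)
    obtain ⟨Q, hQ⟩ := h.exists_isLargeMaxClique v
    have h1 := h.card_clique_le hQ.isClique
    have h2 := hQ.three_le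
    obtain ⟨m, rfl⟩ : ∃ m, k = m + 1 := ⟨k - 1, by omega⟩
    rcases hQ.isCliquePrism_or_exists_circulant h with hP | ⟨f, hf, hadj⟩
    · exact hcon (hP.recolorEquiv hQ h hC hmix α β)
    · exact hcon (recolorEquiv_of_circulant hC hmix (by omega) hf hadj α β)

end SimpleGraph

theorem theorem4 {V : Type*} [Finite V] (G : SimpleGraph V)
    (hP5 : G.IndFree (SimpleGraph.pathGraph 5))
    (hdiamond : G.IndFree SimpleGraph.diamond) :
    G.IsRecolorable := by
  intro l hl
  obtain ⟨k, rfl⟩ : ∃ k, l = k + 1 := by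
    cases l with
    | zero => simp at hl
    | succ k => exact ⟨k, rfl⟩
  have hk : G.Colorable k := by
    rw [← SimpleGraph.chromaticNumber_le_iff_colorable]
    push_cast at hl
    exact (ENat.add_le_add_iff_right ENat.one_ne_top).1 hl
  have hmix := SimpleGraph.mixingAbove_of_indFree _ V G (Nat.lt_succ_self _) hP5 hdiamond
  exact { preconnected := fun α β => (hmix k (Fin (k + 1)) (by simp) hk α β).reachable
          nonempty := hk.mono (Nat.le_succ k) }
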